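/- Let $k$ be a field, and let $G$, $G'$ be finite groups whose orders are not divisible by $\operatorname{char} k$. Write $\mathcal K(G)$ for the set of conjugacy classes of $G$ and $Z_g$ for the centralizer of $g$. **RSR.** A ramification system with irreducible representations $(G,r,\vec\rho,u)$ consists of: a cardinal number $r_C$ for every $C\in\mathcal K(G)$; a map $u:\mathcal K(G)\to G$ with $u(C)\in C$; for every $C$ an index set $I_C(r,u)$ and, for $i\in I_C(r,u)$, an irreducible right representation $\rho_C^{(i)}$ of $Z_{u(C)}$ over $k$ with space $X_C^{(i)}$ and a set $J_C(i)$ with $|J_C(i)|=\deg\rho_C^{(i)}$, such that $I_C(r)=\{(i,j): i\in I_C(r,u),\ j\in J_C(i)\}$ has cardinality $r_C$ (so $I_C(r,u)=\emptyset$ iff $r_C=0$). Two RSRs $(G,r,\vec\rho,u)$ and $(G',r',\vec\rho',u')$ are isomorphic if there are a group isomorphism $\phi:G\to G'$ and, for every $C\in\mathcal K(G)$, an element $h_C\in G$ with $\phi(h_C^{-1}u(C)h_C)=u'(\phi(C))$ and a bijection $\phi_C:I_C(r,u)\to I_{\phi(C)}(r',u')$ such that $\rho_C^{(i)}\cong\rho'^{(\phi_C(i))}_{\phi(C)}\circ\phi_{h_C}$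 as representations of $Z_{u(C)}$ for all $i$, where $\phi_{h}(x)=\phi(h^{-1}xh)$. **The module $(kQ_1^1,\mathrm{ad}(G,r,\vec\rho,u))$.** Let $kQ_1$ have the basis of arrows $a^{(i,j)}_{y,x}$ (from $x$ to $y$), $x,y\in G$, $x^{-1}y\in C$, $(i,j)\in I_C(r)$. For every $C$ choose representatives $g_\theta$ of the cosets $Z_{u(C)}g_\theta$, with $1$ representing $Z_{u(C)}$, and write $g_\theta h=\zeta_\theta(h)g_{\theta'}$ with $\zeta_\theta(h)\in Z_{u(C)}$; choose a basis $\{x_C^{(i,j)}\}_{j\in J_C(i)}$ of each $X_C^{(i)}$. For $x^{-1}y=g_\theta^{-1}u(C)g_\theta$ put $h\cdot a^{(i,j)}_{y,x}=a^{(i,j)}_{hy,hx}$ and $a^{(i,j)}_{y,x}\cdot h=\sum_{s\in J_C(i)}k_s\,a^{(i,s)}_{yh,xh}$, where $x_C^{(i,j)}\cdot\zeta_\theta(h)=\sum_s k_s\,x_C^{(i,s)}$. Then $kQ_1^1$, the span of the arrows starting at $1$, with the action $g\rhd x=g\cdot x\cdot g^{-1}$ and the coaction $a_{y,1}\mapsto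 y\otimes a_{y,1}$, is a (left-left) Yetter–Drinfeld $kG$-module, denoted $(kQ_1^1,\mathrm{ad}(G,r,\vec\rho,u))$. **Nichols algebras.** For a Yetter–Drinfeld $kG$-module $V$, the tensor algebra $T(V)$ is a graded braided Hopf algebra in ${}^{kG}_{kG}\mathcal{YD}$ with $\Delta(v)=v\otimes1+1\otimes v$ for $v\in V$, and $\mathcal B(V)=T(V)/I(V)$, where $I(V)$ is the largest homogeneous two-sided ideal contained in $\bigoplus_{n\ge2}V^{\otimes n}$ that is a coideal and a Yetter–Drinfeld submodule. **Pull-push.** For a Hopf algebra isomorphism $\phi:kG\to kG'$ and a Yetter–Drinfeld $kG'$-module $M$, let ${}^{\phi^{-1}}_{\phi}M$ be the Yetter–Drinfeld $kG$-module $M$ with the action pulled back along $\phi$ and the coaction pushed out along $\phi^{-1}$; for a braided Hopf algebra the other structure maps (and the grading) are kept. **Theorem.** For two RSRs $(G,r,\vec\rho,u)$ and $(G',r',\vec\rho',u')$ over $k$, and any choices of coset representatives and bases as above, the following are equivalent: (i) $(G,r,\vec\rho,u)\cong(G',r',\vec\rho',u')$ as RSRs; (ii) there is a Hopf algebra isomorphism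 $\phi:kG\to kG'$ such that $(kQ_1^1,\mathrm{ad}(G,r,\vec\rho,u))\cong{}^{\phi^{-1}}_{\phi}(kQ_1'^1,\mathrm{ad}(G',r',\vec\rho',u'))$ as Yetter–Drinfeld $kG$-modules; (iii) there is a Hopf algebra isomorphism $\phi:kG\to kG'$ such that $\mathcal B(kQ_1^1,\mathrm{ad}(G,r,\vec\rho,u))\cong{}^{\phi^{-1}}_{\phi}\mathcal B(kQ_1'^1,\mathrm{ad}(G',r',\vec\rho',u'))$ as graded braided Hopf algebras in ${}^{kG}_{kG}\mathcal{YD}$. -/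

import Mathlib

open scoped TensorProduct
open Coalgebra

universe v w v' w'

/-- Left-left Yetter–Drinfeld modules over a Hopf algebra `H`. -/
structure YDModule (k : Type*) (H : Type*) [Field k] [Ring H] [HopfAlgebra k H] where
  carrier : Type w
  [addCommGroup : AddCommGroup carrier]
  [module : Module k carrier]
  /-- the left `H`-action -/
  act : H →ₐ[k] Module.End k carrier
  /-- the left `H`-coaction `x ↦ x₍₋₁₎ ⊗ x₍₀₎` -/
  coact : carrier →ₗ[k] H ⊗[k] carrier
  coassoc : ∀ x, TensorProduct.assoc k H H carrier (comul.rTensor carrier (coact x)) =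
    coact.lTensor H (coact x)
  counit_coact : ∀ x, TensorProduct.lid k carrier (counit.rTensor carrier (coact x)) = x
  /-- `h₍₁₎ x₍₋₁₎ ⊗ h₍₂₎ · x₍₀₎ = (h₍₁₎ · x)₍₋₁₎ h₍₂₎ ⊗ (h₍₁₎ · x)₍₀₎` -/
  compat : ∀ h x,
    TensorProduct.map (LinearMap.mul' k H) (TensorProduct.lift act.toLinearMap)
        (TensorProduct.tensorTensorTensorComm k H H H carrier (comul (R := k) h ⊗ₜ[k] coact x)) =
      (LinearMap.mul' k H).rTensor carrier (TensorProduct.rightComm k H carrier H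
        ((coact ∘ₗ act.toLinearMap.flip x).rTensor H (comul (R := k) h)))

attribute [instance] YDModule.addCommGroup YDModule.module

namespace YDModule

section General

variable {k : Type*} {H H' : Type*} [Field k] [Ring H] [HopfAlgebra k H] [Ring H']
  [HopfAlgebra k H']

/-- `M ≅ N` in the category of Yetter–Drinfeld `H`-modules, through the linear bijection `f`. -/
structure IsIsoMap (M : YDModule.{v} k H) (N : YDModule.{w} k H)
    (f : M.carrier ≃ₗ[k] N.carrier) : Prop where
  map_act : ∀ h x, f (M.act h x) = N.act h (f x)
  map_coact : ∀ x, N.coact (f x) = f.toLinearMap.lTensor H (M.coact x)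

/-- `M ≅ N` in the category of Yetter–Drinfeld `H`-modules. -/
def Isomorphic (M : YDModule.{v} k H) (N : YDModule.{w} k H) : Prop :=
  ∃ f : M.carrier ≃ₗ[k] N.carrier, IsIsoMap M N f

/-- The Yetter–Drinfeld `H`-module obtained from an `H'`-module by pulling the action back along
the Hopf algebra isomorphism `φ : H → H'` and pushing the coaction out along `φ⁻¹`. -/
def pullPush (φ : H ≃ₐc[k] H') (M : YDModule.{w} k H') : YDModule.{w} k H where
  carrier := M.carrier
  act := M.act.comp ((φ : H ≃ₐ[k] H') : H →ₐ[k] H')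
  coact := ((φ.symm : H' ≃ₗc[k] H) : H' →ₗ[k] H).rTensor M.carrier ∘ₗ M.coact
  coassoc x := by
    have key : ∀ s : H' ⊗[k] M.carrier,
        TensorProduct.assoc k H H M.carrier (comul.rTensor M.carrier
          (((φ.symm : H' ≃ₗc[k] H) : H' →ₗ[k] H).rTensor M.carrier s)) =
        TensorProduct.map ((φ.symm : H' ≃ₗc[k] H) : H' →ₗ[k] H)
          (((φ.symm : H' ≃ₗc[k] H) : H' →ₗ[k] H).rTensor M.carrier)
          (TensorProduct.assoc k H' H' M.carrier (comul.rTensor M.carrier s)) := by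
      intro s
      induction s using TensorProduct.induction_on with
      | zero => simp
      | add a b ha hb => simp only [map_add, ha, hb]
      | tmul a m =>
        have h1 : comul (R := k) (φ.symm a) =
            TensorProduct.map ((φ.symm : H' ≃ₗc[k] H) : H' →ₗ[k] H)
              ((φ.symm : H' ≃ₗc[k] H) : H' →ₗ[k] H) (comul (R := k) a) :=
          (CoalgHomClass.map_comp_comul_apply (φ.symm : H' ≃ₗc[k] H) a).symm
        change TensorProduct.assoc k H H M.carrier (comul (R := k) (φ.symm a) ⊗ₜ m) =
          TensorProduct.map _ _ (TensorProduct.assoc k H' H' M.carrier (comul (R := k) a ⊗ₜ m))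
        rw [h1]
        generalize comul (R := k) a = t
        induction t using TensorProduct.induction_on with
        | zero => simp
        | add a b ha hb => simp only [map_add, TensorProduct.add_tmul, ha, hb]
        | tmul a b => simp
    rw [LinearMap.comp_apply, key, M.coassoc]
    generalize M.coact x = s
    induction s using TensorProduct.induction_on with
    | zero => simp
    | add a b ha hb => simp only [map_add, ha, hb]
    | tmul a m => simp
  counit_coact x := by
    conv_rhs => rw [← M.counit_coact x]
    rw [LinearMap.comp_apply]
    generalize M.coact x = s
    induction s using TensorProduct.induction_on with
    | zero => simp
    | add a b ha hb => simp only [map_add, ha, hb]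
    | tmul a m => simp
  compat h x := by
    have h1 : comul (R := k) (φ h) =
        TensorProduct.map ((φ : H ≃ₗc[k] H') : H →ₗ[k] H')
          ((φ : H ≃ₗc[k] H') : H →ₗ[k] H') (comul (R := k) h) :=
      (CoalgHomClass.map_comp_comul_apply (φ : H ≃ₗc[k] H') h).symm
    have h2 := congrArg (((φ.symm : H' ≃ₗc[k] H) : H' →ₗ[k] H).rTensor M.carrier)
      (M.compat (φ h) x)
    rw [h1] at h2
    refine Eq.trans ?_ (h2.trans ?_)
    · rw [LinearMap.comp_apply]
      generalize M.coact x = s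
      generalize comul (R := k) h = t
      induction t using TensorProduct.induction_on with
      | zero => simp
      | add a b ha hb => simp only [map_add, TensorProduct.add_tmul, ha, hb]
      | tmul a b =>
        induction s using TensorProduct.induction_on with
        | zero => simp
        | add a b ha hb => simp only [map_add, TensorProduct.tmul_add, ha, hb]
        | tmul c m =>
          have e1 : φ.symm (φ a * c) = a * φ.symm c := by
            rw [map_mul, φ.symm_apply_apply]
          simp only [TensorProduct.map_tmul, LinearMap.rTensor_tmul,
            TensorProduct.tensorTensorTensorComm_tmul, LinearMap.mul'_apply,
            TensorProduct.lift.tmul]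
          exact congrArg (· ⊗ₜ[k] M.act (φ b) m) e1.symm
    · generalize comul (R := k) h = t
      induction t using TensorProduct.induction_on with
      | zero => simp
      | add a b ha hb => simp only [map_add, ha, hb]
      | tmul a b =>
        simp only [TensorProduct.map_tmul, LinearMap.rTensor_tmul, LinearMap.comp_apply,
          LinearMap.flip_apply]
        change _ = (LinearMap.mul' k H).rTensor M.carrier (TensorProduct.rightComm k H M.carrier H
          ((((φ.symm : H' ≃ₗc[k] H) : H' →ₗ[k] H).rTensor M.carrier
            (M.coact (M.act (φ a) x))) ⊗ₜ b))
        change (((φ.symm : H' ≃ₗc[k] H) : H' →ₗ[k] H).rTensor M.carrier)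
          ((LinearMap.mul' k H').rTensor M.carrier (TensorProduct.rightComm k H' M.carrier H'
            (M.coact (M.act (φ a) x) ⊗ₜ φ b))) = _
        generalize M.coact (M.act (φ a) x) = s
        induction s using TensorProduct.induction_on with
        | zero => simp
        | add a b ha hb => simp only [map_add, TensorProduct.add_tmul, ha, hb]
        | tmul c m =>
          have e1 : φ.symm (c * φ b) = φ.symm c * b := by
            rw [map_mul, φ.symm_apply_apply]
          simp only [LinearMap.rTensor_tmul, TensorProduct.rightComm_tmul, LinearMap.mul'_apply]
          exact congrArg (· ⊗ₜ[k] m) e1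

end General
end YDModule

namespace YDModule

section GroupAlgebra

variable {k : Type*} {G : Type*} [Field k] [Group G]

/-- Over the group algebra it suffices to give the action of the group elements; the
Yetter–Drinfeld condition then reads `g x₍₋₁₎ ⊗ g · x₍₀₎ = (g · x)₍₋₁₎ g ⊗ (g · x)₍₀₎`. -/
noncomputable def ofRep (V : Type w) [AddCommGroup V] [Module k V] (ρ : Representation k G V)
    (δ : V →ₗ[k] MonoidAlgebra k G ⊗[k] V)
    (coassoc : ∀ x, TensorProduct.assoc k _ _ V (comul.rTensor V (δ x)) = δ.lTensor _ (δ x))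
    (counit_coact : ∀ x, TensorProduct.lid k V (counit.rTensor V (δ x)) = x)
    (compat : ∀ g x,
      TensorProduct.map (LinearMap.mulLeft k (MonoidAlgebra.of k G g)) (ρ g) (δ x) =
        (LinearMap.mulRight k (MonoidAlgebra.of k G g)).rTensor V (δ (ρ g x))) :
    YDModule.{w} k (MonoidAlgebra k G) where
  carrier := V
  act := ρ.asAlgebraHom
  coact := δ
  coassoc := coassoc
  counit_coact := counit_coact
  compat h x := by
    induction h using MonoidAlgebra.induction_on with
    | add a b ha hb => simp only [map_add, TensorProduct.add_tmul, ha, hb]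
    | smul r a ha => simp only [map_smul, ← TensorProduct.smul_tmul', ha]
    | of g =>
      have hc : comul (R := k) (MonoidAlgebra.of k G g) =
          MonoidAlgebra.of k G g ⊗ₜ[k] MonoidAlgebra.of k G g := by simp
      rw [hc]
      have := compat g x
      simp only [LinearMap.rTensor_tmul, LinearMap.comp_apply, LinearMap.flip_apply,
        AlgHom.toLinearMap_apply, Representation.asAlgebraHom_of]
      generalize hd : δ (ρ g x) = t at this ⊢
      trans TensorProduct.map (LinearMap.mulLeft k (MonoidAlgebra.of k G g)) (ρ g) (δ x)
      · generalize δ x = s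
        induction s using TensorProduct.induction_on with
        | zero => simp
        | add a b ha hb => simp only [map_add, TensorProduct.tmul_add, ha, hb]
        | tmul a m => simp
      · rw [this]
        generalize t = s
        induction s using TensorProduct.induction_on with
        | zero => simp
        | add a b ha hb => simp only [map_add, TensorProduct.add_tmul, ha, hb]
        | tmul a m => simp

/-- The braiding `x ⊗ y ↦ x₍₋₁₎ · y ⊗ x₍₀₎` of Yetter–Drinfeld modules. -/
noncomputable def braiding {H M N : Type*} [Ring H] [Algebra k H] [AddCommGroup M] [Module k M]
    [AddCommGroup N] [Module k N] (act : H →ₐ[k] Module.End k N) (coact : M →ₗ[k] H ⊗[k] M) :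
    M ⊗[k] N →ₗ[k] N ⊗[k] M :=
  (TensorProduct.lift act.toLinearMap).rTensor M ∘ₗ
    (TensorProduct.rightComm k H M N).toLinearMap ∘ₗ coact.rTensor N

/-- The multiplication `(a ⊗ b)(c ⊗ d) = a (b₍₋₁₎ · c) ⊗ b₍₀₎ d` of the braided tensor product of
an algebra in the Yetter–Drinfeld category with itself. -/
noncomputable def braidedMul {H A : Type*} [Ring H] [Algebra k H] [Ring A] [Algebra k A]
    (act : H →ₐ[k] Module.End k A) (coact : A →ₗ[k] H ⊗[k] A) :
    A ⊗[k] A →ₗ[k] A ⊗[k] A →ₗ[k] A ⊗[k] A :=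
  TensorProduct.curry
    (TensorProduct.map (LinearMap.mul' k A) (LinearMap.mul' k A) ∘ₗ
      (TensorProduct.assoc k A A (A ⊗[k] A)).symm.toLinearMap ∘ₗ
      ((TensorProduct.assoc k A A A).toLinearMap ∘ₗ (braiding act coact).rTensor A ∘ₗ
        (TensorProduct.assoc k A A A).symm.toLinearMap).lTensor A ∘ₗ
      (TensorProduct.assoc k A A (A ⊗[k] A)).toLinearMap)

variable (V : YDModule.{w} k (MonoidAlgebra k G))

theorem act_of_compat (g : G) (x : V.carrier) :
    TensorProduct.map (LinearMap.mulLeft k (MonoidAlgebra.of k G g))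
        (V.act (MonoidAlgebra.of k G g)) (V.coact x) =
      (LinearMap.mulRight k (MonoidAlgebra.of k G g)).rTensor V.carrier
        (V.coact (V.act (MonoidAlgebra.of k G g) x)) := by
  have hc : comul (R := k) (MonoidAlgebra.of k G g) =
    MonoidAlgebra.of k G g ⊗ₜ[k] MonoidAlgebra.of k G g := by simp
  have h := V.compat (MonoidAlgebra.of k G g) x
  rw [hc] at h
  refine Eq.trans ?_ (h.trans ?_)
  · generalize V.coact x = s
    induction s using TensorProduct.induction_on with
    | zero => simp
    | add a b ha hb => simp only [map_add, TensorProduct.tmul_add, ha, hb]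
    | tmul a m => simp
  · simp only [LinearMap.rTensor_tmul, LinearMap.comp_apply, LinearMap.flip_apply,
      AlgHom.toLinearMap_apply]
    generalize V.coact (V.act (MonoidAlgebra.of k G g) x) = s
    induction s using TensorProduct.induction_on with
    | zero => simp
    | add a b ha hb => simp only [map_add, TensorProduct.add_tmul, ha, hb]
    | tmul a m => simp

/-- The quotient of a Yetter–Drinfeld module by a Yetter–Drinfeld submodule. -/
noncomputable def ofSurjective {N : Type v} [AddCommGroup N] [Module k N]
    (π : V.carrier →ₗ[k] N) (hπ : Function.Surjective π) (ρ : Representation k G N)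
    (δ : N →ₗ[k] MonoidAlgebra k G ⊗[k] N)
    (hρ : ∀ g x, ρ g (π x) = π (V.act (MonoidAlgebra.of k G g) x))
    (hδ : ∀ x, δ (π x) = π.lTensor (MonoidAlgebra k G) (V.coact x)) :
    YDModule.{v} k (MonoidAlgebra k G) :=
  ofRep N ρ δ
    (fun x => by
      obtain ⟨x, rfl⟩ := hπ x
      have h := congrArg ((π.lTensor (MonoidAlgebra k G)).lTensor (MonoidAlgebra k G))
        (V.coassoc x)
      rw [hδ]
      refine Eq.trans ?_ (h.trans ?_)
      · generalize V.coact x = s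
        induction s using TensorProduct.induction_on with
        | zero => simp
        | add a b ha hb => simp only [map_add, ha, hb]
        | tmul a m =>
          simp only [LinearMap.lTensor_tmul, LinearMap.rTensor_tmul]
          generalize comul (R := k) a = t
          induction t using TensorProduct.induction_on with
          | zero => simp
          | add a b ha hb => simp only [map_add, TensorProduct.add_tmul, ha, hb]
          | tmul a b => simp
      · generalize V.coact x = s
        induction s using TensorProduct.induction_on with
        | zero => simp
        | add a b ha hb => simp only [map_add, ha, hb]
        | tmul a m => simp [hδ])
    (fun x => by
      obtain ⟨x, rfl⟩ := hπ x
      rw [hδ]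
      refine Eq.trans ?_ (congrArg π (V.counit_coact x))
      generalize V.coact x = s
      induction s using TensorProduct.induction_on with
      | zero => simp
      | add a b ha hb => simp only [map_add, ha, hb]
      | tmul a m => simp)
    (fun g x => by
      obtain ⟨x, rfl⟩ := hπ x
      rw [hρ, hδ, hδ]
      refine Eq.trans ?_ ((congrArg (π.lTensor (MonoidAlgebra k G))
        (V.act_of_compat g x)).trans ?_)
      · generalize V.coact x = s
        induction s using TensorProduct.induction_on with
        | zero => simp
        | add a b ha hb => simp only [map_add, ha, hb]
        | tmul a m => simp only [TensorProduct.map_tmul, LinearMap.lTensor_tmul, hρ]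
      · generalize V.coact (V.act (MonoidAlgebra.of k G g) x) = s
        induction s using TensorProduct.induction_on with
        | zero => simp
        | add a b ha hb => simp only [map_add, ha, hb]
        | tmul a m => simp)

/-- The tensor algebra `T(V)`. -/
abbrev T : Type _ := TensorAlgebra k V.carrier

/-- The diagonal action of `G` on `T(V)`: every `g` acts by the algebra map that extends
`v ↦ g · v`. -/
noncomputable def tensorRep : Representation k G V.T where
  toFun g := (TensorAlgebra.lift k
    (TensorAlgebra.ι k ∘ₗ V.act (MonoidAlgebra.of k G g))).toLinearMap
  map_one' := by
    rw [map_one, map_one, Module.End.one_eq_id, LinearMap.comp_id, Module.End.one_eq_id,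
      ← AlgHom.toLinearMap_id]
    congr 1
    ext; simp
  map_mul' g h := by
    rw [Module.End.mul_eq_comp, ← AlgHom.comp_toLinearMap]
    congr 1
    ext x
    simp only [map_mul, LinearMap.comp_apply, AlgHom.toLinearMap_apply, AlgHom.comp_apply,
      TensorAlgebra.lift_ι_apply, Module.End.mul_apply]

/-- The codiagonal coaction of `kG` on `T(V)`: the algebra map that extends the coaction of `V`. -/
noncomputable def tensorCoact : V.T →ₐ[k] MonoidAlgebra k G ⊗[k] V.T :=
  TensorAlgebra.lift k ((TensorAlgebra.ι k).lTensor (MonoidAlgebra k G) ∘ₗ V.coact)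

theorem tensorRep_compat (g : G) (x : V.T) :
    TensorProduct.map (LinearMap.mulLeft k (MonoidAlgebra.of k G g)) (V.tensorRep g)
        (V.tensorCoact.toLinearMap x) =
      (LinearMap.mulRight k (MonoidAlgebra.of k G g)).rTensor V.T
        (V.tensorCoact.toLinearMap (V.tensorRep g x)) := by
  have key : (MonoidAlgebra.of k G g ⊗ₜ[k] (1 : V.T)) *
      (Algebra.TensorProduct.map (AlgHom.id k (MonoidAlgebra k G)) (TensorAlgebra.lift k
        (TensorAlgebra.ι k ∘ₗ V.act (MonoidAlgebra.of k G g)))) (V.tensorCoact x) =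
      V.tensorCoact (V.tensorRep g x) * (MonoidAlgebra.of k G g ⊗ₜ[k] (1 : V.T)) := by
    induction x using TensorAlgebra.induction with
    | algebraMap r =>
      have e : V.tensorRep g (algebraMap k V.T r) = algebraMap k V.T r := AlgHom.commutes _ r
      rw [e, AlgHom.commutes, AlgHom.commutes, Algebra.commutes]
    | add a b ha hb => simp only [map_add, mul_add, add_mul, ha, hb]
    | mul a b ha hb =>
      have e : V.tensorRep g (a * b) = V.tensorRep g a * V.tensorRep g b :=
        map_mul (TensorAlgebra.lift k
          (TensorAlgebra.ι k ∘ₗ V.act (MonoidAlgebra.of k G g))) a b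
      rw [e, map_mul, map_mul, map_mul, ← mul_assoc, ha, mul_assoc, hb, mul_assoc]
    | ι v =>
      have e : V.tensorRep g (TensorAlgebra.ι k v) =
        TensorAlgebra.ι k (V.act (MonoidAlgebra.of k G g) v) := by simp [tensorRep]
      have e' : ∀ v, V.tensorCoact (TensorAlgebra.ι k v) =
          (TensorAlgebra.ι k).lTensor (MonoidAlgebra k G) (V.coact v) := by
        simp [tensorCoact]
      have h := V.act_of_compat g v
      rw [e, e', e']
      have h' := congrArg ((TensorAlgebra.ι k).lTensor (MonoidAlgebra k G)) h
      refine Eq.trans ?_ (h'.trans ?_)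
      · generalize V.coact v = s
        induction s using TensorProduct.induction_on with
        | zero => simp
        | add a b ha hb => simp only [map_add, mul_add, ha, hb]
        | tmul a m => simp
      · generalize V.coact (V.act (MonoidAlgebra.of k G g) v) = s
        induction s using TensorProduct.induction_on with
        | zero => simp
        | add a b ha hb => simp only [map_add, add_mul, ha, hb]
        | tmul a m => simp
  refine Eq.trans ?_ (key.trans ?_)
  · rw [AlgHom.toLinearMap_apply]
    generalize V.tensorCoact x = s
    induction s using TensorProduct.induction_on with
    | zero => simp
    | add a b ha hb => simp only [map_add, mul_add, ha, hb]
    | tmul a m => simp [tensorRep]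
  · rw [AlgHom.toLinearMap_apply]
    generalize V.tensorCoact (V.tensorRep g x) = s
    induction s using TensorProduct.induction_on with
    | zero => simp
    | add a b ha hb => simp only [map_add, add_mul, ha, hb]
    | tmul a m => simp

/-- `T(V)` as a Yetter–Drinfeld module. -/
noncomputable def tensorYD : YDModule k (MonoidAlgebra k G) :=
  ofRep V.T V.tensorRep V.tensorCoact.toLinearMap
    (fun x => by
      have : ((Algebra.TensorProduct.assoc k k k _ _ _).toAlgHom.comp
          ((Algebra.TensorProduct.map (Bialgebra.comulAlgHom k (MonoidAlgebra k G))
            (AlgHom.id k V.T)).comp V.tensorCoact)) =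
          (Algebra.TensorProduct.map (AlgHom.id k (MonoidAlgebra k G)) V.tensorCoact).comp
            V.tensorCoact := by
        ext v
        have h := congrArg (((TensorAlgebra.ι k).lTensor (MonoidAlgebra k G)).lTensor
          (MonoidAlgebra k G)) (V.coassoc v)
        have e : V.tensorCoact (TensorAlgebra.ι k v) =
            (TensorAlgebra.ι k).lTensor (MonoidAlgebra k G) (V.coact v) := by
          simp [tensorCoact]
        change TensorProduct.assoc k _ _ V.T (comul.rTensor V.T
            (V.tensorCoact (TensorAlgebra.ι k v))) =
          V.tensorCoact.toLinearMap.lTensor _ (V.tensorCoact (TensorAlgebra.ι k v))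
        rw [e]
        refine Eq.trans ?_ (h.trans ?_)
        · generalize V.coact v = s
          induction s using TensorProduct.induction_on with
          | zero => simp
          | add a b ha hb => simp only [map_add, ha, hb]
          | tmul a m =>
            simp only [LinearMap.lTensor_tmul, LinearMap.rTensor_tmul]
            generalize comul (R := k) a = t
            induction t using TensorProduct.induction_on with
            | zero => simp
            | add a b ha hb => simp only [map_add, TensorProduct.add_tmul, ha, hb]
            | tmul a b => simp
        · generalize V.coact v = s
          induction s using TensorProduct.induction_on with
          | zero => simp
          | add a b ha hb => simp only [map_add, ha, hb]
          | tmul a m => simp [tensorCoact]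
      exact DFunLike.congr_fun this x)
    (fun x => by
      have : ((Algebra.TensorProduct.lid k V.T).toAlgHom.comp
          ((Algebra.TensorProduct.map (Bialgebra.counitAlgHom k (MonoidAlgebra k G))
            (AlgHom.id k V.T)).comp V.tensorCoact)) = AlgHom.id k V.T := by
        ext v
        have h := congrArg (TensorAlgebra.ι k) (V.counit_coact v)
        have e : V.tensorCoact (TensorAlgebra.ι k v) =
            (TensorAlgebra.ι k).lTensor (MonoidAlgebra k G) (V.coact v) := by
          simp [tensorCoact]
        change TensorProduct.lid k V.T (counit.rTensor V.T
            (V.tensorCoact (TensorAlgebra.ι k v))) = TensorAlgebra.ι k v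
        rw [e]
        refine Eq.trans ?_ h
        generalize V.coact v = s
        induction s using TensorProduct.induction_on with
        | zero => simp
        | add a b ha hb => simp only [map_add, ha, hb]
        | tmul a m => simp
      exact DFunLike.congr_fun this x)
    V.tensorRep_compat

/-- The comultiplication of `T(V)`: the algebra map from `T(V)` to the braided tensor product
`T(V) ⊗ T(V)` with `v ↦ v ⊗ 1 + 1 ⊗ v`, so `v₁ ⋯ vₙ` is sent to
`(v₁ ⊗ 1 + 1 ⊗ v₁) ⋯ (vₙ ⊗ 1 + 1 ⊗ vₙ) (1 ⊗ 1)`. -/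
noncomputable def tensorComul : V.T →ₗ[k] V.T ⊗[k] V.T :=
  LinearMap.applyₗ (1 ⊗ₜ[k] 1) ∘ₗ
    (TensorAlgebra.lift k (A := Module.End k (V.T ⊗[k] V.T))
      (braidedMul V.tensorRep.asAlgebraHom V.tensorCoact.toLinearMap ∘ₗ
        ((TensorProduct.mk k V.T V.T).flip 1 + TensorProduct.mk k V.T V.T 1) ∘ₗ
          TensorAlgebra.ι k)).toLinearMap

/-- The counit of `T(V)`: the algebra map with `v ↦ 0`. -/
noncomputable def tensorCounit : V.T →ₐ[k] k := TensorAlgebra.lift k 0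

/-- The degree `n` part of `T(V)`. -/
noncomputable def tensorDegree (n : ℕ) : Submodule k V.T :=
  LinearMap.range (TensorAlgebra.ι k (M := V.carrier)) ^ n

/-- The homogeneous two-sided ideals of `T(V)` contained in `⨁_{n ≥ 2} T(V)₍ₙ₎` that are
Yetter–Drinfeld submodules and coideals. -/
structure IsNicholsIdeal (J : Ideal V.T) : Prop where
  isTwoSided : J.IsTwoSided
  isHomogeneous : J.IsHomogeneous
    (fun n : ℕ => LinearMap.range (TensorAlgebra.ι k (M := V.carrier)) ^ n)
  le_degree : J.restrictScalars k ≤ ⨆ n : ℕ, V.tensorDegree (n + 2)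
  act_mem : ∀ g, ∀ x ∈ J, V.tensorRep g x ∈ J
  coact_mem : ∀ x ∈ J, V.tensorCoact x ∈
    LinearMap.range ((J.restrictScalars k).subtype.lTensor (MonoidAlgebra k G))
  comul_mem : ∀ x ∈ J, V.tensorComul x ∈
    LinearMap.range ((J.restrictScalars k).subtype.rTensor V.T) ⊔
      LinearMap.range ((J.restrictScalars k).subtype.lTensor V.T)
  counit_eq : ∀ x ∈ J, V.tensorCounit x = 0

/-- The defining ideal of the Nichols algebra: the largest ideal as above. -/
noncomputable def nicholsIdeal : Ideal V.T := sSup {J | V.IsNicholsIdeal J}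

end GroupAlgebra
end YDModule

namespace YDModule

section Nichols

variable {k : Type*} {G : Type*} [Field k] [Group G] (V : YDModule.{w} k (MonoidAlgebra k G))

instance nicholsIdeal_isTwoSided : V.nicholsIdeal.IsTwoSided := by
  refine ⟨fun {a} b ha => ?_⟩
  have h : V.nicholsIdeal ≤
      Submodule.comap (LinearMap.toSpanSingleton V.T V.T b) V.nicholsIdeal := by
    refine sSup_le fun J hJ x hx => ?_
    have := hJ.isTwoSided
    have hJI : J ≤ V.nicholsIdeal := le_sSup hJ
    exact hJI (Ideal.mul_mem_right b J hx)
  exact h ha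

/-- To check a linear condition on the ideal it suffices to check it on the ideals that it is
the sum of. -/
theorem nicholsIdeal_le_ker {N : Type*} [AddCommGroup N] [Module k N] (f : V.T →ₗ[k] N)
    (hf : ∀ J, V.IsNicholsIdeal J → ∀ x ∈ J, f x = 0) {x : V.T} (hx : x ∈ V.nicholsIdeal) :
    f x = 0 := by
  have hx' : x ∈ ⨆ J : {J | V.IsNicholsIdeal J}, (J : Ideal V.T) := by
    rw [← sSup_eq_iSup']
    exact hx
  refine Submodule.iSup_induction _ (motive := fun y => f y = 0) hx' (fun J y hy => hf J.1 J.2 y hy)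
    (map_zero f) (fun y z hy hz => ?_)
  rw [map_add, hy, hz, add_zero]

/-- The Nichols algebra `𝓑(V)`, as an algebra. -/
def Nichols : Type _ := V.T ⧸ V.nicholsIdeal

noncomputable instance : Ring V.Nichols := inferInstanceAs (Ring (V.T ⧸ V.nicholsIdeal))

noncomputable instance : Algebra k V.Nichols :=
  inferInstanceAs (Algebra k (V.T ⧸ V.nicholsIdeal))

/-- The projection `T(V) → 𝓑(V)`. -/
noncomputable def nicholsMk : V.T →ₐ[k] V.Nichols := Ideal.Quotient.mkₐ k V.nicholsIdeal

theorem nicholsMk_surjective : Function.Surjective V.nicholsMk :=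
  Ideal.Quotient.mkₐ_surjective k V.nicholsIdeal

theorem nicholsMk_eq_zero {x : V.T} (hx : x ∈ V.nicholsIdeal) : V.nicholsMk x = 0 :=
  Ideal.Quotient.eq_zero_iff_mem.2 hx

/-- A linear map on `T(V)` that kills the defining ideal, as a linear map on `𝓑(V)`. -/
noncomputable def nicholsLift {N : Type*} [AddCommGroup N] [Module k N] (f : V.T →ₗ[k] N)
    (hf : ∀ J, V.IsNicholsIdeal J → ∀ x ∈ J, f x = 0) : V.Nichols →ₗ[k] N :=
  (V.nicholsIdeal.restrictScalars k).liftQ f (fun _ hx => V.nicholsIdeal_le_ker f hf hx) ∘ₗ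
    (Submodule.Quotient.restrictScalarsEquiv k V.nicholsIdeal).symm.toLinearMap

@[simp]
theorem nicholsLift_mk {N : Type*} [AddCommGroup N] [Module k N] (f : V.T →ₗ[k] N)
    (hf : ∀ J, V.IsNicholsIdeal J → ∀ x ∈ J, f x = 0) (x : V.T) :
    V.nicholsLift f hf (V.nicholsMk x) = f x := rfl

theorem nicholsMk_of_mem {J : Ideal V.T} (hJ : V.IsNicholsIdeal J) {x : V.T} (hx : x ∈ J) :
    V.nicholsMk x = 0 :=
  V.nicholsMk_eq_zero ((le_sSup hJ : J ≤ V.nicholsIdeal) hx)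

theorem nicholsMk_comp_subtype {J : Ideal V.T} (hJ : V.IsNicholsIdeal J) :
    V.nicholsMk.toLinearMap ∘ₗ (J.restrictScalars k).subtype = 0 :=
  LinearMap.ext fun x => V.nicholsMk_of_mem hJ x.2

/-- The action of `G` on `𝓑(V)` induced from `T(V)`. -/
noncomputable def nicholsRep : Representation k G V.Nichols where
  toFun g := V.nicholsLift (V.nicholsMk.toLinearMap ∘ₗ V.tensorRep g)
    (fun _ hJ x hx => V.nicholsMk_of_mem hJ (hJ.act_mem g x hx))
  map_one' := by
    ext x
    obtain ⟨x, rfl⟩ := V.nicholsMk_surjective x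
    simp
  map_mul' g h := by
    ext x
    obtain ⟨x, rfl⟩ := V.nicholsMk_surjective x
    change V.nicholsMk (V.tensorRep (g * h) x) = V.nicholsMk (V.tensorRep g (V.tensorRep h x))
    rw [map_mul]
    rfl

/-- The coaction of `kG` on `𝓑(V)` induced from `T(V)`. -/
noncomputable def nicholsCoact : V.Nichols →ₗ[k] MonoidAlgebra k G ⊗[k] V.Nichols :=
  V.nicholsLift (V.nicholsMk.toLinearMap.lTensor (MonoidAlgebra k G) ∘ₗ
      V.tensorCoact.toLinearMap) (fun J hJ x hx => by
    obtain ⟨y, hy⟩ := hJ.coact_mem x hx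
    rw [LinearMap.comp_apply, AlgHom.toLinearMap_apply, ← hy, ← LinearMap.comp_apply,
      ← LinearMap.lTensor_comp, V.nicholsMk_comp_subtype hJ, LinearMap.lTensor_zero,
      LinearMap.zero_apply])

/-- The comultiplication of `𝓑(V)` induced from `T(V)`. -/
noncomputable def nicholsComul : V.Nichols →ₗ[k] V.Nichols ⊗[k] V.Nichols :=
  V.nicholsLift (TensorProduct.map V.nicholsMk.toLinearMap V.nicholsMk.toLinearMap ∘ₗ
      V.tensorComul) (fun J hJ x hx => by
    obtain ⟨_, ⟨y, rfl⟩, _, ⟨z, rfl⟩, hyz⟩ := Submodule.mem_sup.1 (hJ.comul_mem x hx)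
    rw [LinearMap.comp_apply, ← hyz, map_add, LinearMap.rTensor, LinearMap.lTensor,
      ← LinearMap.comp_apply, ← LinearMap.comp_apply, ← TensorProduct.map_comp,
      ← TensorProduct.map_comp, V.nicholsMk_comp_subtype hJ, TensorProduct.map_zero_left,
      TensorProduct.map_zero_right, LinearMap.zero_apply, LinearMap.zero_apply, add_zero])

/-- The counit of `𝓑(V)` induced from `T(V)`. -/
noncomputable def nicholsCounit : V.Nichols →ₗ[k] k :=
  V.nicholsLift V.tensorCounit.toLinearMap (fun _ hJ x hx => hJ.counit_eq x hx)

/-- The degree `n` part of `𝓑(V)`. -/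
noncomputable def nicholsDegree (n : ℕ) : Submodule k V.Nichols :=
  (V.tensorDegree n).map V.nicholsMk.toLinearMap

/-- `𝓑(V)` as a Yetter–Drinfeld module. -/
noncomputable def nicholsYD : YDModule k (MonoidAlgebra k G) :=
  V.tensorYD.ofSurjective V.nicholsMk.toLinearMap V.nicholsMk_surjective V.nicholsRep V.nicholsCoact
    (fun g x => by
      change V.nicholsRep g (V.nicholsMk x) =
        V.nicholsMk (V.tensorRep.asAlgebraHom (MonoidAlgebra.of k G g) x)
      rw [Representation.asAlgebraHom_of]
      rfl)
    (fun _ => rfl)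

variable {G' : Type*} [Group G'] (W : YDModule.{v} k (MonoidAlgebra k G'))

/-- `𝓑(V)` is isomorphic to the pull-push of `𝓑(W)` along the Hopf algebra isomorphism
`φ : kG → kG'`, as graded braided Hopf algebras in the category of Yetter–Drinfeld `kG`-modules.
The pull-push changes only the action and the coaction, not the algebra, the coalgebra and the
grading; a bijection that respects the bialgebra structure also respects the antipodes. -/
def NicholsIsomorphic (φ : MonoidAlgebra k G ≃ₐc[k] MonoidAlgebra k G') : Prop :=
  ∃ f : V.Nichols ≃ₐ[k] W.Nichols,
    IsIsoMap V.nicholsYD (pullPush φ W.nicholsYD) f.toLinearEquiv ∧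
    (∀ x, W.nicholsComul (f x) =
      TensorProduct.map f.toLinearMap f.toLinearMap (V.nicholsComul x)) ∧
    (∀ x, W.nicholsCounit (f x) = V.nicholsCounit x) ∧
    ∀ n, (V.nicholsDegree n).map f.toLinearMap = W.nicholsDegree n

end Nichols
end YDModule

/-- A ramification system with irreducible representations `(G, r, ρ, u)` over `k`. The
representations of the centralizers are right modules `x · z = ρ (op z) x`. The index sets `I C`
are given for all conjugacy classes; `I C` is empty exactly when `r C = 0`. -/
structure RSR (k : Type*) (G : Type*) [Field k] [Group G] where
  /-- the ramification `r = ∑ r_C C` -/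
  r : ConjClasses G → Cardinal.{v}
  u : ConjClasses G → G
  mk_u : ∀ C, ConjClasses.mk (u C) = C
  /-- the index set `I_C(r, u)` -/
  I : ConjClasses G → Type v
  /-- the representation space of `ρ_C^{(i)}` -/
  X : ∀ C, I C → Type w
  [addCommGroup : ∀ C i, AddCommGroup (X C i)]
  [module : ∀ C i, Module k (X C i)]
  ρ : ∀ C i, Representation k (Subgroup.centralizer {u C})ᵐᵒᵖ (X C i)
  irreducible : ∀ C i, (ρ C i).IsIrreducible
  /-- the index set `J_C(i)`, with `|J_C(i)| = deg ρ_C^{(i)}` -/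
  J : ∀ C, I C → Type v
  card_J : ∀ C i, Cardinal.lift.{w} (Cardinal.mk (J C i)) =
    Cardinal.lift.{v} (Module.rank k (X C i))
  /-- `I_C(r) = {(i, j) | i ∈ I_C(r, u), j ∈ J_C(i)}` has cardinality `r_C` -/
  card_I : ∀ C, Cardinal.mk (Σ i : I C, J C i) = r C

attribute [instance] RSR.addCommGroup RSR.module

namespace RSR

section Isomorphic

variable {k : Type*} {G G' : Type*} [Field k] [Group G] [Group G']

/-- The homomorphism `φ_h : x ↦ φ (h⁻¹ x h)` between the centralizers of `a` and of
`b = φ (h⁻¹ a h)`. -/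
def centralizerMap (φ : G ≃* G') (h a : G) (b : G') (hb : φ (h⁻¹ * a * h) = b) :
    Subgroup.centralizer {a} →* Subgroup.centralizer {b} where
  toFun x := ⟨φ (h⁻¹ * x * h), by
    have hx : (x : G) * a = a * x := Subgroup.mem_centralizer_singleton_iff.1 x.2
    rw [Subgroup.mem_centralizer_singleton_iff, ← hb, ← map_mul, ← map_mul]
    congr 1
    calc h⁻¹ * x * h * (h⁻¹ * a * h) = h⁻¹ * (x * a) * h := by group
      _ = h⁻¹ * (a * x) * h := by rw [hx]
      _ = h⁻¹ * a * h * (h⁻¹ * x * h) := by group⟩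
  map_one' := by ext; simp
  map_mul' x y := by
    ext
    simp only [Subgroup.coe_mul, ← map_mul]
    congr 1
    group

/-- Isomorphism of ramification systems with irreducible representations. For a conjugacy class
with `r_C = 0` the bijection says that `r'_{φ(C)} = 0`. -/
def Isomorphic (R : RSR.{v, w} k G) (R' : RSR.{v', w'} k G') : Prop :=
  ∃ φ : G ≃* G', ∀ C : ConjClasses G,
    ∃ (h : G) (hh : φ (h⁻¹ * R.u C * h) = R'.u (C.map φ.toMonoidHom))
      (e : R.I C ≃ R'.I (C.map φ.toMonoidHom)),
      ∀ i, Nonempty ((R.ρ C i).Equiv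
        ((R'.ρ (C.map φ.toMonoidHom) (e i)).comp (MonoidHom.op (centralizerMap φ h _ _ hh))))

end Isomorphic

section Arrows

variable {k : Type*} {G : Type*} [Field k] [Group G] (R : RSR.{v, w} k G)

/-- The arrows `a_{y,x}^{(i,j)}` of the Hopf quiver of `G` with respect to `r`: the arrows from
`x` to `y` are labelled by `(i, j) ∈ I_C(r)`, where `C` is the class of `x⁻¹ y`. -/
structure Arrow where
  src : G
  tgt : G
  cls : ConjClasses G
  mk_eq : ConjClasses.mk (src⁻¹ * tgt) = cls
  i : R.I cls
  j : R.J cls i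

variable {R}

/-- `a_{hy,hx}^{(i,j)}` -/
def Arrow.left (h : G) (a : R.Arrow) : R.Arrow where
  src := h * a.src
  tgt := h * a.tgt
  cls := a.cls
  mk_eq := by rw [← a.mk_eq]; congr 1; group
  i := a.i
  j := a.j

/-- `a_{yh,xh}^{(i,s)}` -/
def Arrow.right (a : R.Arrow) (h : G) (s : R.J a.cls a.i) : R.Arrow where
  src := a.src * h
  tgt := a.tgt * h
  cls := a.cls
  mk_eq := by
    rw [← a.mk_eq]
    exact (ConjClasses.mk_eq_mk_iff_isConj.2 (isConj_iff.2 ⟨h, by group⟩))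
  i := a.i
  j := s

variable (R)

/-- The left action `h · a_{y,x}^{(i,j)} = a_{hy,hx}^{(i,j)}` on `kQ₁`. -/
noncomputable def leftAct (h : G) : (R.Arrow →₀ k) →ₗ[k] (R.Arrow →₀ k) :=
  Finsupp.lmapDomain k k (Arrow.left h)

/-- The choices that enter the description of the arrow bimodule: representatives `g_θ` of the
right cosets of the centralizers `Z_{u(C)}` (with `1` representing `Z_{u(C)}`) and bases
`{x_C^{(i,j)} | j ∈ J_C(i)}` of the representation spaces. -/
structure Choices where
  reps : ConjClasses G → Set G
  one_mem : ∀ C, 1 ∈ reps C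
  isComplement : ∀ C,
    Subgroup.IsComplement (Subgroup.centralizer {R.u C} : Set G) (reps C)
  basis : ∀ C i, Module.Basis (R.J C i) k (R.X C i)

namespace Choices

variable {R} (D : R.Choices)

theorem exists_theta {C : ConjClasses G} {y : G} (hy : ConjClasses.mk y = C) :
    ∃ t ∈ D.reps C, y = t⁻¹ * R.u C * t := by
  rw [← R.mk_u C, eq_comm, ConjClasses.mk_eq_mk_iff_isConj, isConj_iff] at hy
  obtain ⟨c, hc⟩ := hy
  have e := (D.isComplement C).equiv_fst_mul_equiv_snd c⁻¹
  set z := ((D.isComplement C).equiv c⁻¹).1 with hz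
  set t := ((D.isComplement C).equiv c⁻¹).2 with ht
  refine ⟨t, t.2, ?_⟩
  have hz' : R.u C * (z : G) = z * R.u C := (Subgroup.mem_centralizer_singleton_iff.1 z.2).symm
  have hc' : c = (t : G)⁻¹ * (z : G)⁻¹ := by rw [← mul_inv_rev, e, inv_inv]
  rw [← hc, hc']
  calc (t : G)⁻¹ * (z : G)⁻¹ * R.u C * ((t : G)⁻¹ * (z : G)⁻¹)⁻¹
      = (t : G)⁻¹ * ((z : G)⁻¹ * (R.u C * z)) * t := by group
    _ = (t : G)⁻¹ * R.u C * t := by rw [hz']; group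

/-- The representative `g_θ` with `x⁻¹ y = g_θ⁻¹ u(C) g_θ`, for an arrow from `x` to `y`. -/
noncomputable def theta (a : R.Arrow) : G := (D.exists_theta a.mk_eq).choose

/-- `ζ_θ(h) ∈ Z_{u(C)}`, given by `g_θ h = ζ_θ(h) g_θ'`; here `t = g_θ`. -/
noncomputable def zeta (C : ConjClasses G) (t h : G) : Subgroup.centralizer {R.u C} :=
  ((D.isComplement C).equiv (t * h)).1

/-- The right action `a_{y,x}^{(i,j)} · h = ∑ₛ k_{C,h}^{(i,j,s)} a_{yh,xh}^{(i,s)}` on `kQ₁`, where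
`x_C^{(i,j)} · ζ_θ(h) = ∑ₛ k_{C,h}^{(i,j,s)} x_C^{(i,s)}`. -/
noncomputable def rightAct (h : G) : (R.Arrow →₀ k) →ₗ[k] (R.Arrow →₀ k) :=
  Finsupp.linearCombination k fun a =>
    Finsupp.mapDomain (a.right h) ((D.basis a.cls a.i).repr
      (R.ρ a.cls a.i (MulOpposite.op (D.zeta a.cls (D.theta a) h)) (D.basis a.cls a.i a.j)))

theorem theta_mem (a : R.Arrow) : D.theta a ∈ D.reps a.cls :=
  (D.exists_theta a.mk_eq).choose_spec.1

theorem theta_spec (a : R.Arrow) :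
    a.src⁻¹ * a.tgt = (D.theta a)⁻¹ * R.u a.cls * D.theta a :=
  (D.exists_theta a.mk_eq).choose_spec.2

theorem theta_unique (a : R.Arrow) {t : G} (ht : t ∈ D.reps a.cls)
    (h : a.src⁻¹ * a.tgt = t⁻¹ * R.u a.cls * t) : D.theta a = t := by
  have hz : D.theta a * t⁻¹ ∈ Subgroup.centralizer {R.u a.cls} := by
    rw [Subgroup.mem_centralizer_singleton_iff]
    have h' := (D.theta_spec a).symm.trans h
    calc D.theta a * t⁻¹ * R.u a.cls = D.theta a * (t⁻¹ * R.u a.cls * t) * t⁻¹ := by group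
      _ = D.theta a * ((D.theta a)⁻¹ * R.u a.cls * D.theta a) * t⁻¹ := by rw [h']
      _ = R.u a.cls * (D.theta a * t⁻¹) := by group
  have := (D.isComplement a.cls).1
    (a₁ := (⟨1, Subgroup.one_mem _⟩, ⟨D.theta a, D.theta_mem a⟩)) (a₂ := (⟨_, hz⟩, ⟨t, ht⟩))
    (by simp)
  exact congrArg (fun p => (p.2 : G)) this

theorem theta_right (a : R.Arrow) (h : G) (s : R.J a.cls a.i) :
    D.theta (a.right h s) = ((D.isComplement a.cls).equiv (D.theta a * h)).2 := by
  refine D.theta_unique (a.right h s) (Subtype.prop _) ?_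
  have e := (D.isComplement a.cls).equiv_fst_mul_equiv_snd (D.theta a * h)
  set z := ((D.isComplement a.cls).equiv (D.theta a * h)).1
  set t := ((D.isComplement a.cls).equiv (D.theta a * h)).2
  have hz : (z : G) * R.u a.cls = R.u a.cls * z := Subgroup.mem_centralizer_singleton_iff.1 z.2
  change (a.src * h)⁻¹ * (a.tgt * h) = (t : G)⁻¹ * R.u a.cls * t
  calc (a.src * h)⁻¹ * (a.tgt * h) = h⁻¹ * (a.src⁻¹ * a.tgt) * h := by group
    _ = (D.theta a * h)⁻¹ * R.u a.cls * (D.theta a * h) := by rw [D.theta_spec]; group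
    _ = (t : G)⁻¹ * (z : G)⁻¹ * (R.u a.cls * z) * t := by rw [← e]; group
    _ = (t : G)⁻¹ * R.u a.cls * t := by rw [← hz]; group

theorem zeta_one (a : R.Arrow) : D.zeta a.cls (D.theta a) 1 = 1 := by
  rw [zeta, mul_one]
  exact (D.isComplement a.cls).equiv_fst_eq_one_of_mem_of_one_mem
    (Subgroup.one_mem _) (D.theta_mem a)

theorem zeta_mul (a : R.Arrow) (g h : G) (s : R.J a.cls a.i) :
    D.zeta a.cls (D.theta a) (g * h) =
      D.zeta a.cls (D.theta a) g * D.zeta a.cls (D.theta (a.right g s)) h := by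
  have e := (D.isComplement a.cls).equiv_fst_mul_equiv_snd (D.theta a * g)
  have e' : D.theta a * (g * h) =
      (D.zeta a.cls (D.theta a) g : G) * (D.theta (a.right g s) * h) := by
    rw [D.theta_right, ← mul_assoc, ← mul_assoc]
    exact congrArg (· * h) e.symm
  rw [zeta, e', (D.isComplement a.cls).equiv_mul_left]
  rfl

theorem theta_left (a : R.Arrow) (g : G) : D.theta (a.left g) = D.theta a := by
  refine D.theta_unique (a.left g) (D.theta_mem a) ?_
  change (g * a.src)⁻¹ * (g * a.tgt) = (D.theta a)⁻¹ * R.u a.cls * D.theta a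
  rw [← D.theta_spec]
  group

theorem rightAct_single (a : R.Arrow) (h : G) :
    D.rightAct h (Finsupp.single a 1) =
      Finsupp.mapDomain (a.right h) ((D.basis a.cls a.i).repr
        (R.ρ a.cls a.i (MulOpposite.op (D.zeta a.cls (D.theta a) h)) (D.basis a.cls a.i a.j))) := by
  simp [rightAct]

theorem rightAct_one : D.rightAct 1 = LinearMap.id := by
  ext1 a
  ext1
  simp only [LinearMap.comp_apply, Finsupp.lsingle_apply, rightAct_single, zeta_one,
    MulOpposite.op_one, map_one, Module.End.one_apply, Module.Basis.repr_self,
    Finsupp.mapDomain_single, LinearMap.id_apply]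
  congr 1
  rcases a with ⟨x, y, C, hC, i, j⟩
  simp [Arrow.right]

theorem rightAct_mul (g h : G) : D.rightAct (g * h) = D.rightAct h ∘ₗ D.rightAct g := by
  ext1 a
  ext1
  simp only [LinearMap.comp_apply, Finsupp.lsingle_apply, rightAct_single, D.zeta_mul a g h a.j,
    MulOpposite.op_mul, map_mul, Module.End.mul_apply]
  generalize R.ρ a.cls a.i (MulOpposite.op (D.zeta a.cls (D.theta a) g)) (D.basis a.cls a.i a.j) = x
  have key : Finsupp.lmapDomain k k (a.right (g * h)) ∘ₗ
      (D.basis a.cls a.i).repr.toLinearMap ∘ₗ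
        R.ρ a.cls a.i (MulOpposite.op (D.zeta a.cls (D.theta (a.right g a.j)) h)) =
      D.rightAct h ∘ₗ Finsupp.lmapDomain k k (a.right g) ∘ₗ
        (D.basis a.cls a.i).repr.toLinearMap := by
    refine (D.basis a.cls a.i).ext fun s => ?_
    have e : D.theta (a.right g a.j) = D.theta (a.right g s) := by
      rw [D.theta_right, D.theta_right]
    simp only [LinearMap.comp_apply, LinearEquiv.coe_coe, Module.Basis.repr_self,
      Finsupp.lmapDomain_apply, Finsupp.mapDomain_single, rightAct_single]
    rw [e]
    have hf : a.right (g * h) = (a.right g s).right h := by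
      funext t
      simp [Arrow.right, mul_assoc]
    rw [hf]
    rfl
  exact LinearMap.congr_fun key x

theorem rightAct_leftAct (g h : G) :
    D.rightAct h ∘ₗ R.leftAct g = R.leftAct g ∘ₗ D.rightAct h := by
  ext1 a
  ext1
  simp only [LinearMap.comp_apply, Finsupp.lsingle_apply, leftAct, Finsupp.lmapDomain_apply,
    Finsupp.mapDomain_single, rightAct_single, theta_left, ← Finsupp.mapDomain_comp]
  have hf : (a.left g).right h = Arrow.left g ∘ a.right h := by
    funext t
    simp [Arrow.right, Arrow.left, mul_assoc, Function.comp]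
  rw [hf]
  rfl

end Choices
end Arrows
end RSR

namespace RSR

section ArrowYD

variable {k : Type*} {G : Type*} [Field k] [Group G] (R : RSR.{v, w} k G)

/-- `Q₁¹`, the arrows that start at the vertex `1`. -/
abbrev ArrowOne : Type _ := {a : R.Arrow // a.src = 1}

/-- The inclusion `kQ₁¹ → kQ₁`. -/
noncomputable def incl : (R.ArrowOne →₀ k) →ₗ[k] (R.Arrow →₀ k) :=
  Finsupp.lmapDomain k k Subtype.val

/-- The projection of `kQ₁` onto `kQ₁¹` that kills the other arrows. -/
noncomputable def proj : (R.Arrow →₀ k) →ₗ[k] (R.ArrowOne →₀ k) :=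
  Finsupp.lcomapDomain Subtype.val Subtype.val_injective

theorem proj_incl (x : R.ArrowOne →₀ k) : R.proj (R.incl x) = x :=
  Finsupp.comapDomain_mapDomain _ Subtype.val_injective x

/-- The left arrow coaction `a_{y,1} ↦ y ⊗ a_{y,1}` on `kQ₁¹`. -/
noncomputable def arrowCoact : (R.ArrowOne →₀ k) →ₗ[k] MonoidAlgebra k G ⊗[k] (R.ArrowOne →₀ k) :=
  Finsupp.linearCombination k fun a =>
    MonoidAlgebra.of k G a.1.tgt ⊗ₜ[k] Finsupp.single a (1 : k)

theorem arrowCoact_single (a : R.ArrowOne) :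
    R.arrowCoact (Finsupp.single a 1) =
      MonoidAlgebra.of k G a.1.tgt ⊗ₜ[k] Finsupp.single a (1 : k) := by
  simp [arrowCoact]

theorem leftAct_one : R.leftAct 1 = LinearMap.id := by
  ext1 a
  ext1
  simp [leftAct, Arrow.left]

theorem leftAct_mul (g h : G) : R.leftAct (g * h) = R.leftAct g ∘ₗ R.leftAct h := by
  ext1 a
  ext1
  simp [leftAct, Arrow.left, mul_assoc]

namespace Choices

variable {R} (D : R.Choices)

/-- The arrow `a_{gyg⁻¹,1}^{(i,s)}`, for an arrow `a_{y,1}^{(i,j)}`. -/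
def conjArrow (g : G) (a : R.ArrowOne) (s : R.J a.1.cls a.1.i) : R.ArrowOne :=
  ⟨(a.1.left g).right g⁻¹ s, by simp [Arrow.right, Arrow.left, a.2]⟩

/-- The adjoint action `g ▷ x = g · x · g⁻¹` on `kQ₁¹`. -/
noncomputable def adjoint (g : G) : (R.ArrowOne →₀ k) →ₗ[k] (R.ArrowOne →₀ k) :=
  R.proj ∘ₗ D.rightAct g⁻¹ ∘ₗ R.leftAct g ∘ₗ R.incl

theorem rightAct_leftAct_incl (g : G) (a : R.ArrowOne) :
    D.rightAct g⁻¹ (R.leftAct g (R.incl (Finsupp.single a 1))) =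
      R.incl (Finsupp.mapDomain (conjArrow g a) ((D.basis a.1.cls a.1.i).repr
        (R.ρ a.1.cls a.1.i (MulOpposite.op (D.zeta a.1.cls (D.theta a.1) g⁻¹))
          (D.basis a.1.cls a.1.i a.1.j)))) := by
  simp only [incl, leftAct, Finsupp.lmapDomain_apply, Finsupp.mapDomain_single, rightAct_single,
    theta_left, ← Finsupp.mapDomain_comp]
  rfl

theorem adjoint_single (g : G) (a : R.ArrowOne) :
    D.adjoint g (Finsupp.single a 1) =
      Finsupp.mapDomain (conjArrow g a) ((D.basis a.1.cls a.1.i).repr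
        (R.ρ a.1.cls a.1.i (MulOpposite.op (D.zeta a.1.cls (D.theta a.1) g⁻¹))
          (D.basis a.1.cls a.1.i a.1.j))) := by
  simp only [adjoint, LinearMap.comp_apply, rightAct_leftAct_incl, proj_incl]

theorem incl_adjoint (g : G) (x : R.ArrowOne →₀ k) :
    R.incl (D.adjoint g x) = D.rightAct g⁻¹ (R.leftAct g (R.incl x)) := by
  have : R.incl ∘ₗ D.adjoint g = D.rightAct g⁻¹ ∘ₗ R.leftAct g ∘ₗ R.incl := by
    ext1 a
    ext1
    simp only [LinearMap.comp_apply, Finsupp.lsingle_apply, adjoint_single, rightAct_leftAct_incl]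
  exact LinearMap.congr_fun this x

/-- The adjoint action as a representation of `G`. -/
noncomputable def adjointRep : Representation k G (R.ArrowOne →₀ k) where
  toFun := D.adjoint
  map_one' := by
    ext1 a
    ext1
    simp only [adjoint, inv_one, rightAct_one, leftAct_one, LinearMap.comp_apply,
      LinearMap.id_apply, proj_incl, Module.End.one_apply]
  map_mul' g h := by
    refine LinearMap.ext fun x => ?_
    have e : R.incl (D.adjoint (g * h) x) = R.incl (D.adjoint g (D.adjoint h x)) := by
      rw [incl_adjoint, incl_adjoint, incl_adjoint, leftAct_mul, mul_inv_rev, rightAct_mul,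
        LinearMap.comp_apply, LinearMap.comp_apply]
      congr 1
      exact LinearMap.congr_fun (D.rightAct_leftAct g h⁻¹) (R.leftAct h (R.incl x))
    exact (R.proj_incl _).symm.trans ((congrArg R.proj e).trans (R.proj_incl _))

theorem arrowCoact_mapDomain (g : G) (a : R.ArrowOne) (c : R.J a.1.cls a.1.i →₀ k) :
    R.arrowCoact (Finsupp.mapDomain (conjArrow g a) c) =
      MonoidAlgebra.of k G (g * a.1.tgt * g⁻¹) ⊗ₜ[k] Finsupp.mapDomain (conjArrow g a) c := by
  have : R.arrowCoact ∘ₗ Finsupp.lmapDomain k k (conjArrow g a) =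
      TensorProduct.mk k _ _ (MonoidAlgebra.of k G (g * a.1.tgt * g⁻¹)) ∘ₗ
        Finsupp.lmapDomain k k (conjArrow g a) := by
    ext1 s
    ext1
    simp only [LinearMap.comp_apply, Finsupp.lsingle_apply, Finsupp.lmapDomain_apply,
      Finsupp.mapDomain_single, arrowCoact_single, TensorProduct.mk_apply]
    rfl
  exact LinearMap.congr_fun this c

/-- The Yetter–Drinfeld module `(kQ₁¹, ad(G, r, ρ, u))`. -/
noncomputable def arrowYD : YDModule k (MonoidAlgebra k G) :=
  YDModule.ofRep (R.ArrowOne →₀ k) D.adjointRep R.arrowCoact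
    (fun x => by
      induction x using Finsupp.induction_linear with
      | zero => simp
      | add x y hx hy => simp only [map_add, hx, hy]
      | single a r =>
        have hr : Finsupp.single a r = r • Finsupp.single a (1 : k) := by simp
        rw [hr]
        simp only [map_smul, arrowCoact_single]
        congr 1
        simp [arrowCoact_single])
    (fun x => by
      induction x using Finsupp.induction_linear with
      | zero => simp
      | add x y hx hy => simp only [map_add, hx, hy]
      | single a r =>
        have hr : Finsupp.single a r = r • Finsupp.single a (1 : k) := by simp
        rw [hr]
        simp only [map_smul, arrowCoact_single]
        congr 1
        simp)
    (fun g x => by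
      induction x using Finsupp.induction_linear with
      | zero => simp
      | add x y hx hy => simp only [map_add, hx, hy]
      | single a r =>
        have hr : Finsupp.single a r = r • Finsupp.single a (1 : k) := by simp
        rw [hr]
        simp only [map_smul, arrowCoact_single]
        congr 1
        change (MonoidAlgebra.of k G g * MonoidAlgebra.of k G a.1.tgt) ⊗ₜ[k]
            D.adjoint g (Finsupp.single a 1) =
          (LinearMap.mulRight k (MonoidAlgebra.of k G g)).rTensor _
            (R.arrowCoact (D.adjoint g (Finsupp.single a 1)))
        rw [adjoint_single, arrowCoact_mapDomain, LinearMap.rTensor_tmul, LinearMap.mulRight_apply,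
          ← map_mul, ← map_mul]
        simp)

end Choices
end ArrowYD
end RSR

/-! The bases and coset representatives hide a coordinate-free object: $kQ_1^1$ is the direct sum,
over all $C$ and $i \in I_C(r,u)$, of the induced modules $X_C^{(i)} \otimes_{kZ_{u(C)}} kG$. Here
$h \rhd (x \otimes g) = x \otimes gh^{-1}$, and $x \otimes g$ has degree $g^{-1}u(C)g$. The elements
$x \otimes g$ are given by `ind`, the two formulas are `adjoint_ind` and `arrowCoact_ind`, and
`exists_lift` is the universal property.

From (i) to (ii): with linear isomorphisms $T$ between corresponding representations, $x \otimes g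
\mapsto T x \otimes \phi(h_C^{-1}g)$ is well defined over the centralizers and respects actions and
degrees (`exists_isSemiIso_of_equiv`).

From (ii) to (iii): the defining ideal is the supremum of a class of ideals described only by
structure on $T(V)$ that is functorial in $V$. So an isomorphism of the modules descends to the
Nichols algebras (`IsSemiIso.nicholsIsomorphic`).

From (iii) to (i): the ideal lies in degrees at least two, so $V$ is the degree one part of
$\mathcal B(V)$ and an isomorphism of the modules is recovered
(`NicholsIsomorphic.exists_isSemiIso`). Group-like elements turn the Hopf isomorphism into a group
isomorphism $\psi$. The part of degree $u(C)$ is $\bigoplus_i X_C^{(i)}$ as a representation of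
$Z_{u(C)}$. It is carried to the part of degree $\psi(u(C))$, a translate of $\bigoplus_j
X'^{(j)}_{\psi(C)}$ (`exists_directSum_equiv`). What remains is uniqueness of decompositions into
irreducibles with possibly infinite index sets (`exists_equiv_of_directSum_equiv`): Schur's lemma
separates the isomorphism types, and the multiplicity of a type is obtained by dividing the
dimension of its isotypic part by a finite nonzero number. -/

namespace YDModule

/-! ### Isomorphisms over a varying Hopf algebra -/

section Semilinear

variable {k : Type*} {H H' : Type*} [Field k] [Ring H] [HopfAlgebra k H] [Ring H']
  [HopfAlgebra k H']

/-- A linear bijection between Yetter–Drinfeld modules over different Hopf algebras that respects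
the actions and the coactions up to the Hopf algebra isomorphism `φ`. -/
structure IsSemiIso (φ : H ≃ₐc[k] H') (M : YDModule.{v} k H) (N : YDModule.{w} k H')
    (f : M.carrier ≃ₗ[k] N.carrier) : Prop where
  map_act : ∀ h x, f (M.act h x) = N.act (φ h) (f x)
  map_coact : ∀ x, N.coact (f x) =
    TensorProduct.map ((φ : H ≃ₗc[k] H') : H →ₗ[k] H') f.toLinearMap (M.coact x)

theorem rTensor_symm_map {P Q : Type*} [AddCommGroup P] [Module k P] [AddCommGroup Q] [Module k Q]
    (φ : H ≃ₐc[k] H') (f : P →ₗ[k] Q) (s : H ⊗[k] P) :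
    ((φ.symm : H' ≃ₗc[k] H) : H' →ₗ[k] H).rTensor Q
      (TensorProduct.map ((φ : H ≃ₗc[k] H') : H →ₗ[k] H') f s) = f.lTensor H s := by
  induction s using TensorProduct.induction_on with
  | zero => simp
  | add a b ha hb => simp only [map_add, ha, hb]
  | tmul a m =>
    have e : φ.symm (φ a) = a := φ.symm_apply_apply a
    exact congrArg (· ⊗ₜ[k] f m) e

theorem map_rTensor_symm {Q : Type*} [AddCommGroup Q] [Module k Q]
    (φ : H ≃ₐc[k] H') (s : H' ⊗[k] Q) :
    ((φ : H ≃ₗc[k] H') : H →ₗ[k] H').rTensor Q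
      (((φ.symm : H' ≃ₗc[k] H) : H' →ₗ[k] H).rTensor Q s) = s := by
  induction s using TensorProduct.induction_on with
  | zero => simp
  | add a b ha hb => simp only [map_add, ha, hb]
  | tmul a m =>
    have e : φ (φ.symm a) = a := φ.apply_symm_apply a
    exact congrArg (· ⊗ₜ[k] m) e

/-- Applying $\varphi$ to the Hopf algebra factor undoes the push-out of the coaction, and the
pulled-back action is the semilinear condition by definition. After this the transported structures
are no longer needed, and the semilinear notion can be inverted symmetrically. -/
theorem isIsoMap_pullPush_iff (φ : H ≃ₐc[k] H') (M : YDModule.{v} k H) (N : YDModule.{w} k H')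
    (f : M.carrier ≃ₗ[k] N.carrier) :
    IsIsoMap M (pullPush φ N) f ↔ IsSemiIso φ M N f := by
  constructor
  · intro h
    refine ⟨h.map_act, fun x => ?_⟩
    have e := congrArg (((φ : H ≃ₗc[k] H') : H →ₗ[k] H').rTensor N.carrier) (h.map_coact x)
    have e' := (map_rTensor_symm φ (N.coact (f x))).symm.trans e
    exact e'.trans (LinearMap.congr_fun (LinearMap.rTensor_comp_lTensor _ _ _) (M.coact x))
  · intro h
    refine ⟨h.map_act, fun x => ?_⟩
    change ((φ.symm : H' ≃ₗc[k] H) : H' →ₗ[k] H).rTensor N.carrier (N.coact (f x)) = _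
    rw [h.map_coact x]
    exact rTensor_symm_map φ f.toLinearMap (M.coact x)

theorem isomorphic_pullPush_iff (φ : H ≃ₐc[k] H') (M : YDModule.{v} k H) (N : YDModule.{w} k H') :
    M.Isomorphic (pullPush φ N) ↔ ∃ f : M.carrier ≃ₗ[k] N.carrier, IsSemiIso φ M N f :=
  exists_congr fun f => isIsoMap_pullPush_iff φ M N f

theorem IsSemiIso.symm {φ : H ≃ₐc[k] H'} {M : YDModule.{v} k H} {N : YDModule.{w} k H'}
    {f : M.carrier ≃ₗ[k] N.carrier} (h : IsSemiIso φ M N f) : IsSemiIso φ.symm N M f.symm := by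
  refine ⟨fun a x => ?_, fun x => ?_⟩
  · apply f.injective
    have e : φ (φ.symm a) = a := φ.apply_symm_apply a
    rw [h.map_act, f.apply_symm_apply, f.apply_symm_apply, e]
  · obtain ⟨x, rfl⟩ := f.surjective x
    rw [h.map_coact, f.symm_apply_apply]
    generalize M.coact x = s
    induction s using TensorProduct.induction_on with
    | zero => simp
    | add a b ha hb => simp only [map_add, ← ha, ← hb]
    | tmul a m =>
      have e : φ.symm (φ a) = a := φ.symm_apply_apply a
      have e' : f.symm (f m) = m := f.symm_apply_apply m
      exact (congrArg₂ (· ⊗ₜ[k] ·) e e').symm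

end Semilinear

/-! ### Group-like elements and naturality of the braiding -/

section GroupIso

variable {k : Type*} {G G' : Type*} [Field k] [Group G] [Group G']

/-- A Hopf algebra isomorphism between group algebras comes from a group isomorphism. -/
theorem exists_mulEquiv_of_bialgEquiv (φ : MonoidAlgebra k G ≃ₐc[k] MonoidAlgebra k G') :
    ∃ ψ : G ≃* G', ∀ g, φ (MonoidAlgebra.of k G g) = MonoidAlgebra.of k G' (ψ g) := by
  have h1 : ∀ g, MonoidAlgebra.of k G'
      (MonoidAlgebra.mapDomainOfBialgHom (φ : MonoidAlgebra k G →ₐc[k] MonoidAlgebra k G') g) =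
        φ (MonoidAlgebra.of k G g) := fun g =>
    MonoidAlgebra.single_mapDomainOfBialgHom (φ : MonoidAlgebra k G →ₐc[k] MonoidAlgebra k G') g 1
  have h2 : ∀ g, MonoidAlgebra.of k G (MonoidAlgebra.mapDomainOfBialgHom
      (φ.symm : MonoidAlgebra k G' →ₐc[k] MonoidAlgebra k G) g) =
        φ.symm (MonoidAlgebra.of k G' g) := fun g =>
    MonoidAlgebra.single_mapDomainOfBialgHom
      (φ.symm : MonoidAlgebra k G' →ₐc[k] MonoidAlgebra k G) g 1
  refine ⟨MonoidHom.toMulEquiv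
    (MonoidAlgebra.mapDomainOfBialgHom (φ : MonoidAlgebra k G →ₐc[k] MonoidAlgebra k G'))
    (MonoidAlgebra.mapDomainOfBialgHom (φ.symm : MonoidAlgebra k G' →ₐc[k] MonoidAlgebra k G))
    ?_ ?_, fun g => (h1 g).symm⟩
  · ext g
    apply MonoidAlgebra.of_injective (R := k)
    exact (h2 _).trans ((congrArg φ.symm (h1 g)).trans (φ.symm_apply_apply _))
  · ext g
    apply MonoidAlgebra.of_injective (R := k)
    exact (h1 _).trans ((congrArg φ (h2 g)).trans (φ.apply_symm_apply _))

theorem braidedMul_tmul {H A : Type*} [Ring H] [Algebra k H] [Ring A] [Algebra k A]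
    (act : H →ₐ[k] Module.End k A) (coact : A →ₗ[k] H ⊗[k] A) (a b c d : A) :
    braidedMul act coact (a ⊗ₜ b) (c ⊗ₜ d) =
      TensorProduct.map (LinearMap.mulLeft k a) (LinearMap.mulRight k d)
        (braiding act coact (b ⊗ₜ c)) := by
  simp only [braidedMul, TensorProduct.curry_apply, LinearMap.comp_apply, LinearEquiv.coe_coe,
    TensorProduct.assoc_tmul, LinearMap.lTensor_tmul, TensorProduct.assoc_symm_tmul,
    LinearMap.rTensor_tmul]
  generalize braiding act coact (b ⊗ₜ c) = s
  induction s using TensorProduct.induction_on with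
  | zero => simp
  | add x y hx hy => simp only [map_add, TensorProduct.add_tmul, TensorProduct.tmul_add, hx, hy]
  | tmul x y => simp

theorem braiding_map {H H' A A' : Type*} [Ring H] [Algebra k H] [Ring H'] [Algebra k H']
    [AddCommGroup A] [Module k A] [AddCommGroup A'] [Module k A']
    (φ : H →ₗ[k] H') (T : A →ₗ[k] A')
    (act : H →ₐ[k] Module.End k A) (coact : A →ₗ[k] H ⊗[k] A)
    (act' : H' →ₐ[k] Module.End k A') (coact' : A' →ₗ[k] H' ⊗[k] A')
    (hact : ∀ h a, T (act h a) = act' (φ h) (T a))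
    (hcoact : ∀ a, coact' (T a) = TensorProduct.map φ T (coact a)) (b c : A) :
    braiding act' coact' (T b ⊗ₜ T c) = TensorProduct.map T T (braiding act coact (b ⊗ₜ c)) := by
  simp only [braiding, LinearMap.comp_apply, LinearEquiv.coe_coe, LinearMap.rTensor_tmul, hcoact]
  generalize coact b = s
  induction s using TensorProduct.induction_on with
  | zero => simp
  | add x y hx hy => simp only [map_add, TensorProduct.add_tmul, hx, hy]
  | tmul x y => simp [hact]

theorem braidedMul_map {H H' A A' : Type*} [Ring H] [Algebra k H] [Ring H'] [Algebra k H']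
    [Ring A] [Algebra k A] [Ring A'] [Algebra k A'] (φ : H →ₗ[k] H') (T : A ≃ₐ[k] A')
    (act : H →ₐ[k] Module.End k A) (coact : A →ₗ[k] H ⊗[k] A)
    (act' : H' →ₐ[k] Module.End k A') (coact' : A' →ₗ[k] H' ⊗[k] A')
    (hact : ∀ h a, T (act h a) = act' (φ h) (T a))
    (hcoact : ∀ a, coact' (T a) = TensorProduct.map φ T.toLinearMap (coact a))
    (s t : A ⊗[k] A) :
    braidedMul act' coact' (TensorProduct.map T.toLinearMap T.toLinearMap s)
        (TensorProduct.map T.toLinearMap T.toLinearMap t) =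
      TensorProduct.map T.toLinearMap T.toLinearMap (braidedMul act coact s t) := by
  induction s using TensorProduct.induction_on with
  | zero => simp
  | add x y hx hy => simp only [map_add, LinearMap.add_apply, hx, hy]
  | tmul a b =>
    induction t using TensorProduct.induction_on with
    | zero => simp
    | add x y hx hy => simp only [map_add, hx, hy]
    | tmul c d =>
      simp only [TensorProduct.map_tmul, braidedMul_tmul,
        braiding_map φ T.toLinearMap act coact act' coact' hact hcoact b c]
      generalize braiding act coact (b ⊗ₜ c) = s
      induction s using TensorProduct.induction_on with
      | zero => simp
      | add x y hx hy => simp only [map_add, hx, hy]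
      | tmul x y => simp

end GroupIso
end YDModule

namespace YDModule

/-! ### Functoriality of the braided Hopf algebra T(V) -/

section TensorEquiv

variable {k : Type*} {G G' : Type*} [Field k] [Group G] [Group G']
  {V : YDModule.{w} k (MonoidAlgebra k G)} {W : YDModule.{v} k (MonoidAlgebra k G')}

/-- The isomorphism `T(V) ≃ T(W)` induced by a linear bijection `V ≃ W`. -/
noncomputable def tensorEquiv (f : V.carrier ≃ₗ[k] W.carrier) : V.T ≃ₐ[k] W.T :=
  AlgEquiv.ofAlgHom (TensorAlgebra.lift k (TensorAlgebra.ι k ∘ₗ f.toLinearMap))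
    (TensorAlgebra.lift k (TensorAlgebra.ι k ∘ₗ f.symm.toLinearMap))
    (by ext x; simp) (by ext x; simp)

@[simp]
theorem tensorEquiv_ι (f : V.carrier ≃ₗ[k] W.carrier) (x : V.carrier) :
    tensorEquiv f (TensorAlgebra.ι k x) = TensorAlgebra.ι k (f x) := by
  simp [tensorEquiv]

theorem tensorEquiv_symm (f : V.carrier ≃ₗ[k] W.carrier) :
    (tensorEquiv f).symm = tensorEquiv f.symm := rfl

@[simp]
theorem tensorRep_ι (g : G) (x : V.carrier) :
    V.tensorRep g (TensorAlgebra.ι k x) =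
      TensorAlgebra.ι k (V.act (MonoidAlgebra.of k G g) x) := by
  simp [tensorRep]

@[simp]
theorem tensorCoact_ι (x : V.carrier) :
    V.tensorCoact (TensorAlgebra.ι k x) =
      (TensorAlgebra.ι k).lTensor (MonoidAlgebra k G) (V.coact x) := by
  simp [tensorCoact]

theorem tensorDegree_map (f : V.carrier ≃ₗ[k] W.carrier) (n : ℕ) :
    (V.tensorDegree n).map (tensorEquiv f).toLinearMap = W.tensorDegree n := by
  have h1 : (LinearMap.range (TensorAlgebra.ι k (M := V.carrier))).map
      (tensorEquiv f).toLinearMap = LinearMap.range (TensorAlgebra.ι k (M := W.carrier)) := by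
    ext y
    constructor
    · rintro ⟨_, ⟨x, rfl⟩, rfl⟩
      exact ⟨f x, (tensorEquiv_ι f x).symm⟩
    · rintro ⟨x, rfl⟩
      exact ⟨_, ⟨f.symm x, rfl⟩, by simp⟩
  rw [tensorDegree, tensorDegree, ← h1]
  exact Submodule.map_pow _ (tensorEquiv f).toAlgHom n

variable {φ : MonoidAlgebra k G ≃ₐc[k] MonoidAlgebra k G'} {f : V.carrier ≃ₗ[k] W.carrier}

theorem IsSemiIso.tensorRep {ψ : G ≃* G'} (h : IsSemiIso φ V W f)
    (hψ : ∀ g, φ (MonoidAlgebra.of k G g) = MonoidAlgebra.of k G' (ψ g)) (g : G) (x : V.T) :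
    tensorEquiv f (V.tensorRep g x) = W.tensorRep (ψ g) (tensorEquiv f x) := by
  have : (tensorEquiv f).toAlgHom.comp (TensorAlgebra.lift k
      (TensorAlgebra.ι k ∘ₗ V.act (MonoidAlgebra.of k G g))) =
      (TensorAlgebra.lift k (TensorAlgebra.ι k ∘ₗ W.act (MonoidAlgebra.of k G' (ψ g)))).comp
        (tensorEquiv f).toAlgHom := by
    ext x
    have := h.map_act (MonoidAlgebra.of k G g) x
    rw [hψ] at this
    simp [-MonoidAlgebra.of_apply, this]
  exact DFunLike.congr_fun this x

theorem IsSemiIso.tensorRep_asAlgebraHom (h : IsSemiIso φ V W f) (a : MonoidAlgebra k G)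
    (x : V.T) :
    tensorEquiv f (V.tensorRep.asAlgebraHom a x) =
      W.tensorRep.asAlgebraHom (φ a) (tensorEquiv f x) := by
  obtain ⟨ψ, hψ⟩ := exists_mulEquiv_of_bialgEquiv φ
  induction a using MonoidAlgebra.induction_on with
  | add a b ha hb => simp only [map_add, LinearMap.add_apply, ha, hb]
  | smul r a ha => simp only [map_smul, LinearMap.smul_apply, ha]
  | of g => rw [hψ, Representation.asAlgebraHom_of, Representation.asAlgebraHom_of,
      h.tensorRep hψ]

theorem IsSemiIso.tensorCoact (h : IsSemiIso φ V W f) (x : V.T) :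
    W.tensorCoact (tensorEquiv f x) =
      TensorProduct.map ((φ : MonoidAlgebra k G ≃ₗc[k] MonoidAlgebra k G') : _ →ₗ[k] _)
        (tensorEquiv f).toLinearMap (V.tensorCoact x) := by
  have : W.tensorCoact.comp (tensorEquiv f).toAlgHom =
      (Algebra.TensorProduct.map ((φ : MonoidAlgebra k G ≃ₐ[k] MonoidAlgebra k G') :
        MonoidAlgebra k G →ₐ[k] MonoidAlgebra k G') (tensorEquiv f).toAlgHom).comp
          V.tensorCoact := by
    ext x
    change W.tensorCoact (tensorEquiv f (TensorAlgebra.ι k x)) =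
      TensorProduct.map ((φ : MonoidAlgebra k G ≃ₗc[k] MonoidAlgebra k G') : _ →ₗ[k] _)
        (tensorEquiv f).toLinearMap (V.tensorCoact (TensorAlgebra.ι k x))
    rw [tensorEquiv_ι, tensorCoact_ι, tensorCoact_ι, h.map_coact]
    generalize V.coact x = s
    induction s using TensorProduct.induction_on with
    | zero => simp
    | add a b ha hb => simp only [map_add, ha, hb]
    | tmul a m => simp
  exact DFunLike.congr_fun this x

/-- The comultiplication is built from the braided product and its values on generators, and both
are natural: the braided product by `braidedMul_map`, the generators because $f$ is linear. -/
theorem IsSemiIso.tensorComul (h : IsSemiIso φ V W f) (x : V.T) :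
    W.tensorComul (tensorEquiv f x) =
      TensorProduct.map (tensorEquiv f).toLinearMap (tensorEquiv f).toLinearMap
        (V.tensorComul x) := by
  -- The comultiplication is the value at $1 \otimes 1$ of an operator depending multiplicatively on
  -- $x$. Products become compositions, so the induction needs an arbitrary argument $t$.
  have key : ∀ (x : V.T) (t : V.T ⊗[k] V.T),
      TensorAlgebra.lift k (A := Module.End k (W.T ⊗[k] W.T))
        (braidedMul W.tensorRep.asAlgebraHom W.tensorCoact.toLinearMap ∘ₗ
          ((TensorProduct.mk k W.T W.T).flip 1 + TensorProduct.mk k W.T W.T 1) ∘ₗ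
            TensorAlgebra.ι k) (tensorEquiv f x)
          (TensorProduct.map (tensorEquiv f).toLinearMap (tensorEquiv f).toLinearMap t) =
        TensorProduct.map (tensorEquiv f).toLinearMap (tensorEquiv f).toLinearMap
          (TensorAlgebra.lift k (A := Module.End k (V.T ⊗[k] V.T))
            (braidedMul V.tensorRep.asAlgebraHom V.tensorCoact.toLinearMap ∘ₗ
              ((TensorProduct.mk k V.T V.T).flip 1 + TensorProduct.mk k V.T V.T 1) ∘ₗ
                TensorAlgebra.ι k) x t) := by
    intro x
    induction x using TensorAlgebra.induction with
    | algebraMap r => intro t; simp [Module.algebraMap_end_apply]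
    | add a b ha hb => intro t; simp only [map_add, LinearMap.add_apply, ha, hb]
    | mul a b ha hb => intro t; simp only [map_mul, Module.End.mul_apply, ha, hb]
    | ι v =>
      intro t
      rw [tensorEquiv_ι, TensorAlgebra.lift_ι_apply, TensorAlgebra.lift_ι_apply]
      refine Eq.trans ?_ (braidedMul_map
        ((φ : MonoidAlgebra k G ≃ₗc[k] MonoidAlgebra k G') : _ →ₗ[k] _)
        (tensorEquiv f) _ V.tensorCoact.toLinearMap _ W.tensorCoact.toLinearMap
        h.tensorRep_asAlgebraHom (fun a => by
          rw [AlgHom.toLinearMap_apply, AlgHom.toLinearMap_apply]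
          exact h.tensorCoact a) _ t)
      simp only [LinearMap.comp_apply, LinearMap.add_apply, map_add, LinearMap.flip_apply,
        TensorProduct.mk_apply, TensorProduct.map_tmul]
      have e1 : (tensorEquiv f).toLinearMap 1 = 1 := map_one (tensorEquiv f)
      have e2 : (tensorEquiv f).toLinearMap (TensorAlgebra.ι k v) =
        TensorAlgebra.ι k (f v) := tensorEquiv_ι f v
      rw [e1, e2]
  have := key x (1 ⊗ₜ 1)
  refine Eq.trans ?_ this
  simp [YDModule.tensorComul]

theorem tensorCounit_tensorEquiv (f : V.carrier ≃ₗ[k] W.carrier) (x : V.T) :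
    W.tensorCounit (tensorEquiv f x) = V.tensorCounit x := by
  have : W.tensorCounit.comp (tensorEquiv f).toAlgHom = V.tensorCounit := by
    ext x
    simp [tensorCounit]
  exact DFunLike.congr_fun this x

end TensorEquiv
end YDModule

/-! ### Functoriality of the Nichols algebra -/

namespace YDModule

section Restrict

variable {k : Type*} [Field k] {H H' M M' : Type*} [AddCommGroup H] [Module k H] [AddCommGroup H']
  [Module k H'] [AddCommGroup M] [Module k M] [AddCommGroup M'] [Module k M']

/-- A preimage is transported by the restriction of $T$ to $S \to S'$. This moves the subcomodule
condition and one half of the coideal condition to the image ideal. -/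
theorem map_mem_range_lTensor {S : Submodule k M} {S' : Submodule k M'} (φ : H →ₗ[k] H')
    {T : M →ₗ[k] M'} (hT : ∀ x ∈ S, T x ∈ S') {t : H ⊗[k] M}
    (ht : t ∈ LinearMap.range (S.subtype.lTensor H)) :
    TensorProduct.map φ T t ∈ LinearMap.range (S'.subtype.lTensor H') := by
  obtain ⟨s, rfl⟩ := ht
  refine ⟨TensorProduct.map φ (T.restrict hT) s, ?_⟩
  induction s using TensorProduct.induction_on with
  | zero => simp
  | add a b ha hb => simp only [map_add, ha, hb]
  | tmul a m => simp

theorem map_mem_range_rTensor {S : Submodule k M} {S' : Submodule k M'} (φ : H →ₗ[k] H')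
    {T : M →ₗ[k] M'} (hT : ∀ x ∈ S, T x ∈ S') {t : M ⊗[k] H}
    (ht : t ∈ LinearMap.range (S.subtype.rTensor H)) :
    TensorProduct.map T φ t ∈ LinearMap.range (S'.subtype.rTensor H') := by
  obtain ⟨s, rfl⟩ := ht
  refine ⟨TensorProduct.map (T.restrict hT) φ s, ?_⟩
  induction s using TensorProduct.induction_on with
  | zero => simp
  | add a b ha hb => simp only [map_add, ha, hb]
  | tmul a m => simp

end Restrict

section NicholsEquiv

variable {k : Type*} {G G' : Type*} [Field k] [Group G] [Group G']
  {V : YDModule.{w} k (MonoidAlgebra k G)} {W : YDModule.{v} k (MonoidAlgebra k G')}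

theorem tensorEquiv_mem_degree (f : V.carrier ≃ₗ[k] W.carrier) {n : ℕ} {x : V.T}
    (hx : x ∈ V.tensorDegree n) : tensorEquiv f x ∈ W.tensorDegree n := by
  rw [← tensorDegree_map f n]
  exact ⟨x, hx, rfl⟩

theorem decompose_tensorEquiv (f : V.carrier ≃ₗ[k] W.carrier) (x : V.T) (n : ℕ) :
    (DirectSum.decompose
      (fun n : ℕ => LinearMap.range (TensorAlgebra.ι k (M := W.carrier)) ^ n)
        (tensorEquiv f x) n : W.T) =
      tensorEquiv f (DirectSum.decompose
        (fun n : ℕ => LinearMap.range (TensorAlgebra.ι k (M := V.carrier)) ^ n) x n : V.T) := by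
  induction x using DirectSum.Decomposition.inductionOn
    (fun n : ℕ => LinearMap.range (TensorAlgebra.ι k (M := V.carrier)) ^ n) with
  | zero => simp
  | add a b ha hb =>
    simp only [map_add, DirectSum.decompose_add, DirectSum.add_apply, Submodule.coe_add, ha, hb]
  | @homogeneous i m =>
    have hm : tensorEquiv f (m : V.T) ∈
        LinearMap.range (TensorAlgebra.ι k (M := W.carrier)) ^ i := tensorEquiv_mem_degree f m.2
    by_cases h : i = n
    · subst h
      rw [DirectSum.decompose_of_mem_same _ m.2, DirectSum.decompose_of_mem_same (fun n : ℕ =>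
        LinearMap.range (TensorAlgebra.ι k (M := W.carrier)) ^ n) hm]
    · rw [DirectSum.decompose_of_mem_ne _ m.2 h, DirectSum.decompose_of_mem_ne (fun n : ℕ =>
        LinearMap.range (TensorAlgebra.ι k (M := W.carrier)) ^ n) hm h, map_zero]

variable {φ : MonoidAlgebra k G ≃ₐc[k] MonoidAlgebra k G'} {f : V.carrier ≃ₗ[k] W.carrier}

/-- Every defining condition is phrased through structure that `tensorEquiv f` respects. The image
of $J$ is written as a preimage under the inverse, so that it is an ideal by construction. -/
theorem IsSemiIso.isNicholsIdeal (h : IsSemiIso φ V W f) {J : Ideal V.T}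
    (hJ : V.IsNicholsIdeal J) :
    W.IsNicholsIdeal (J.comap (tensorEquiv f).symm) := by
  obtain ⟨ψ, hψ⟩ := exists_mulEquiv_of_bialgEquiv φ
  have := hJ.isTwoSided
  have hT : ∀ x ∈ J.restrictScalars k, (tensorEquiv f).toLinearMap x ∈
      (J.comap (tensorEquiv f).symm).restrictScalars k := by
    intro x hx
    change (tensorEquiv f).symm (tensorEquiv f x) ∈ J
    rwa [AlgEquiv.symm_apply_apply]
  have hT' : ∀ x ∈ J.comap (tensorEquiv f).symm, ∃ y ∈ J, tensorEquiv f y = x :=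
    fun x hx => ⟨(tensorEquiv f).symm x, hx, AlgEquiv.apply_symm_apply _ _⟩
  constructor
  · refine ⟨fun {x} y hx => ?_⟩
    change (tensorEquiv f).symm (x * y) ∈ J
    rw [map_mul]
    exact Ideal.mul_mem_right _ J hx
  · intro n x hx
    obtain ⟨x, hxJ, rfl⟩ := hT' x hx
    rw [decompose_tensorEquiv]
    exact hT _ (hJ.isHomogeneous n hxJ)
  · intro x hx
    obtain ⟨x, hxJ, rfl⟩ := hT' x hx
    simp_rw [← tensorDegree_map f, ← Submodule.map_iSup]
    exact ⟨x, hJ.le_degree hxJ, rfl⟩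
  · intro g x hx
    obtain ⟨x, hxJ, rfl⟩ := hT' x hx
    -- Stability is required under all of $G'$, while $J$ only provides it for elements of $G$.
    obtain ⟨g, rfl⟩ := ψ.surjective g
    rw [← h.tensorRep hψ]
    exact hT _ (hJ.act_mem g x hxJ)
  · intro x hx
    obtain ⟨x, hxJ, rfl⟩ := hT' x hx
    rw [h.tensorCoact]
    exact map_mem_range_lTensor _ hT (hJ.coact_mem x hxJ)
  · intro x hx
    obtain ⟨x, hxJ, rfl⟩ := hT' x hx
    rw [h.tensorComul]
    obtain ⟨y, hy, z, hz, hyz⟩ := Submodule.mem_sup.1 (hJ.comul_mem x hxJ)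
    rw [← hyz, map_add]
    exact Submodule.add_mem_sup (map_mem_range_rTensor _ hT hy) (map_mem_range_lTensor _ hT hz)
  · intro x hx
    obtain ⟨x, hxJ, rfl⟩ := hT' x hx
    rw [tensorCounit_tensorEquiv]
    exact hJ.counit_eq x hxJ

/-- One inclusion is enough: it gives a homomorphism of the quotients, and the same statement for
the inverse isomorphism gives the inverse homomorphism. -/
theorem IsSemiIso.nicholsIdeal_le (h : IsSemiIso φ V W f) :
    V.nicholsIdeal ≤ W.nicholsIdeal.comap (tensorEquiv f) := by
  refine sSup_le fun J hJ x hx => ?_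
  have hle : J.comap (tensorEquiv f).symm ≤ W.nicholsIdeal := le_sSup (h.isNicholsIdeal hJ)
  apply hle
  change (tensorEquiv f).symm (tensorEquiv f x) ∈ J
  rwa [AlgEquiv.symm_apply_apply]

/-- The homomorphism of Nichols algebras induced by an isomorphism of Yetter–Drinfeld modules. -/
noncomputable def IsSemiIso.nicholsHom (h : IsSemiIso φ V W f) : V.Nichols →ₐ[k] W.Nichols :=
  Ideal.Quotient.liftₐ V.nicholsIdeal (W.nicholsMk.comp (tensorEquiv f).toAlgHom)
    (fun _ hx => W.nicholsMk_eq_zero (h.nicholsIdeal_le hx))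

@[simp]
theorem IsSemiIso.nicholsHom_mk (h : IsSemiIso φ V W f) (x : V.T) :
    h.nicholsHom (V.nicholsMk x) = W.nicholsMk (tensorEquiv f x) := rfl

/-- The isomorphism of Nichols algebras induced by an isomorphism of Yetter–Drinfeld modules. -/
noncomputable def IsSemiIso.nicholsEquiv (h : IsSemiIso φ V W f) : V.Nichols ≃ₐ[k] W.Nichols :=
  AlgEquiv.ofAlgHom h.nicholsHom h.symm.nicholsHom
    (by
      refine AlgHom.ext fun x => ?_
      obtain ⟨x, rfl⟩ := W.nicholsMk_surjective x
      rw [AlgHom.comp_apply, h.symm.nicholsHom_mk, h.nicholsHom_mk, ← tensorEquiv_symm,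
        AlgEquiv.apply_symm_apply, AlgHom.id_apply])
    (by
      refine AlgHom.ext fun x => ?_
      obtain ⟨x, rfl⟩ := V.nicholsMk_surjective x
      rw [AlgHom.comp_apply, h.nicholsHom_mk, h.symm.nicholsHom_mk, ← tensorEquiv_symm,
        AlgEquiv.symm_apply_apply, AlgHom.id_apply])

theorem IsSemiIso.nicholsEquiv_mk (h : IsSemiIso φ V W f) (x : V.T) :
    h.nicholsEquiv (V.nicholsMk x) = W.nicholsMk (tensorEquiv f x) := rfl

theorem IsSemiIso.nicholsEquiv_comp_mk (h : IsSemiIso φ V W f) :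
    h.nicholsEquiv.toLinearMap ∘ₗ V.nicholsMk.toLinearMap =
      W.nicholsMk.toLinearMap ∘ₗ (tensorEquiv f).toLinearMap := rfl

theorem nicholsRep_mk (g : G) (x : V.T) :
    V.nicholsRep g (V.nicholsMk x) = V.nicholsMk (V.tensorRep g x) := rfl

theorem nicholsCoact_mk (x : V.T) :
    V.nicholsCoact (V.nicholsMk x) =
      V.nicholsMk.toLinearMap.lTensor (MonoidAlgebra k G) (V.tensorCoact x) := rfl

theorem nicholsComul_mk (x : V.T) :
    V.nicholsComul (V.nicholsMk x) =
      TensorProduct.map V.nicholsMk.toLinearMap V.nicholsMk.toLinearMap (V.tensorComul x) := rfl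

theorem nicholsCounit_mk (x : V.T) :
    V.nicholsCounit (V.nicholsMk x) = V.tensorCounit x := rfl

theorem IsSemiIso.nicholsYD (h : IsSemiIso φ V W f) :
    IsSemiIso φ V.nicholsYD W.nicholsYD h.nicholsEquiv.toLinearEquiv := by
  obtain ⟨ψ, hψ⟩ := exists_mulEquiv_of_bialgEquiv φ
  constructor
  · intro a x
    obtain ⟨x, rfl⟩ := V.nicholsMk_surjective x
    change h.nicholsEquiv (V.nicholsRep.asAlgebraHom a (V.nicholsMk x)) =
      W.nicholsRep.asAlgebraHom (φ a) (h.nicholsEquiv (V.nicholsMk x))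
    induction a using MonoidAlgebra.induction_on with
    | add a b ha hb => simp only [map_add, LinearMap.add_apply, ha, hb]
    | smul r a ha => simp only [map_smul, LinearMap.smul_apply, ha]
    | of g =>
      rw [hψ, Representation.asAlgebraHom_of, Representation.asAlgebraHom_of, nicholsRep_mk,
        nicholsEquiv_mk, nicholsEquiv_mk, nicholsRep_mk, h.tensorRep hψ]
  · intro x
    obtain ⟨x, rfl⟩ := V.nicholsMk_surjective x
    change W.nicholsCoact (h.nicholsEquiv (V.nicholsMk x)) =
      TensorProduct.map ((φ : MonoidAlgebra k G ≃ₗc[k] MonoidAlgebra k G') : _ →ₗ[k] _)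
        h.nicholsEquiv.toLinearMap (V.nicholsCoact (V.nicholsMk x))
    rw [nicholsEquiv_mk, nicholsCoact_mk, nicholsCoact_mk, h.tensorCoact]
    generalize V.tensorCoact x = s
    induction s using TensorProduct.induction_on with
    | zero => simp
    | add a b ha hb => simp only [map_add, ha, hb]
    | tmul a m => simp [nicholsEquiv_mk]

theorem IsSemiIso.nicholsIsomorphic (h : IsSemiIso φ V W f) : NicholsIsomorphic V W φ := by
  refine ⟨h.nicholsEquiv, (isIsoMap_pullPush_iff _ _ _ _).2 h.nicholsYD, fun x => ?_, fun x => ?_,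
    fun n => ?_⟩
  · obtain ⟨x, rfl⟩ := V.nicholsMk_surjective x
    rw [nicholsEquiv_mk, nicholsComul_mk, nicholsComul_mk, h.tensorComul]
    generalize V.tensorComul x = s
    induction s using TensorProduct.induction_on with
    | zero => simp
    | add a b ha hb => simp only [map_add, ha, hb]
    | tmul a m => simp [nicholsEquiv_mk]
  · obtain ⟨x, rfl⟩ := V.nicholsMk_surjective x
    rw [nicholsEquiv_mk, nicholsCounit_mk, nicholsCounit_mk, tensorCounit_tensorEquiv]
  · rw [nicholsDegree, nicholsDegree, ← tensorDegree_map f n, ← Submodule.map_comp,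
      ← Submodule.map_comp, h.nicholsEquiv_comp_mk]

/-! ### Recovering V from the degree one part of its Nichols algebra -/

variable (V) in
/-- The inclusion of `V` into `𝓑(V)` as the part of degree one. -/
noncomputable def nicholsι : V.carrier →ₗ[k] V.Nichols :=
  V.nicholsMk.toLinearMap ∘ₗ TensorAlgebra.ι k

/-- The projection to degree one is the second component of the algebra map from $T(V)$ to the
square-zero extension $k \oplus V$, where a product of two elements without scalar part is zero. -/
theorem ιInv_eq_zero {x : V.T} (hx : x ∈ ⨆ n : ℕ, V.tensorDegree (n + 2)) :
    TensorAlgebra.ιInv x = 0 := by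
  suffices h : (⨆ n : ℕ, V.tensorDegree (n + 2)) ≤
      LinearMap.ker (TensorAlgebra.ιInv (R := k) (M := V.carrier)) from h hx
  -- The square-zero extension needs a bimodule; the right action is the left one.
  let _ : Module kᵐᵒᵖ V.carrier := Module.compHom _ ((RingHom.id k).fromOpposite mul_comm)
  have : IsCentralScalar k V.carrier := ⟨fun r m => rfl⟩
  have hι : ∀ y ∈ LinearMap.range (TensorAlgebra.ι k (M := V.carrier)),
      (TensorAlgebra.toTrivSqZeroExt y).fst = 0 := by
    rintro _ ⟨y, rfl⟩
    rw [TensorAlgebra.toTrivSqZeroExt_ι, TrivSqZeroExt.fst_inr]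
  refine iSup_le fun n => ?_
  rw [tensorDegree, pow_succ, Submodule.mul_le]
  intro a ha b hb
  -- Here $a$ has degree $n + 1$, so it still contains a factor from $V$, which makes its scalar
  -- part vanish.
  have ha' : (TensorAlgebra.toTrivSqZeroExt a).fst = 0 := by
    rw [pow_succ] at ha
    refine Submodule.mul_induction_on ha (fun c hc d hd => ?_) (fun c d hc hd => ?_)
    · rw [map_mul, TrivSqZeroExt.fst_mul, hι d hd, mul_zero]
    · rw [map_add, TrivSqZeroExt.fst_add, hc, hd, add_zero]
  change (TensorAlgebra.toTrivSqZeroExt (a * b)).snd = 0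
  rw [map_mul, TrivSqZeroExt.snd_mul, ha', hι b hb]
  simp

/-- Since the ideal lies in degrees at least two, the projection of $T(V)$ to $V$ factors through
$\mathcal B(V)$ and is a left inverse. -/
theorem nicholsι_injective : Function.Injective V.nicholsι := by
  have hleft : ∀ x, V.nicholsLift TensorAlgebra.ιInv
      (fun J hJ x hx => ιInv_eq_zero (hJ.le_degree hx)) (V.nicholsι x) = x := fun x => by
    rw [nicholsι, LinearMap.comp_apply]
    exact (V.nicholsLift_mk _ _ _).trans (TensorAlgebra.ι_leftInverse x)
  exact Function.LeftInverse.injective hleft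

theorem range_nicholsι : LinearMap.range V.nicholsι = V.nicholsDegree 1 := by
  rw [nicholsι, LinearMap.range_comp, nicholsDegree, tensorDegree, pow_one]

theorem nicholsRep_ι (a : MonoidAlgebra k G) (x : V.carrier) :
    V.nicholsYD.act a (V.nicholsι x) = V.nicholsι (V.act a x) := by
  change V.nicholsRep.asAlgebraHom a (V.nicholsι x) = _
  induction a using MonoidAlgebra.induction_on with
  | add a b ha hb => simp only [map_add, LinearMap.add_apply, ha, hb]
  | smul r a ha => simp only [map_smul, LinearMap.smul_apply, ha]
  | of g =>
    rw [Representation.asAlgebraHom_of]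
    exact congrArg V.nicholsMk (tensorRep_ι g x)

theorem nicholsCoact_ι (x : V.carrier) :
    V.nicholsYD.coact (V.nicholsι x) =
      V.nicholsι.lTensor (MonoidAlgebra k G) (V.coact x) := by
  change V.nicholsCoact (V.nicholsMk (TensorAlgebra.ι k x)) = _
  rw [nicholsCoact_mk, tensorCoact_ι, nicholsι, LinearMap.lTensor_comp, LinearMap.comp_apply]

/-- A graded isomorphism restricts to the degree one parts, which are copies of $V$ and $W$ as
Yetter–Drinfeld modules. -/
theorem NicholsIsomorphic.exists_isSemiIso (h : NicholsIsomorphic V W φ) :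
    ∃ f : V.carrier ≃ₗ[k] W.carrier, IsSemiIso φ V W f := by
  obtain ⟨F, hF, -, -, hdeg⟩ := h
  replace hF := (isIsoMap_pullPush_iff _ _ _ _).1 hF
  let eV := LinearEquiv.ofInjective V.nicholsι nicholsι_injective
  let eW := LinearEquiv.ofInjective W.nicholsι nicholsι_injective
  have hr : (LinearMap.range V.nicholsι).map (F.toLinearEquiv : V.Nichols →ₗ[k] W.Nichols) =
      LinearMap.range W.nicholsι := by
    rw [range_nicholsι, range_nicholsι]
    exact hdeg 1
  let f := eV.trans ((F.toLinearEquiv.submoduleMap _).trans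
    ((LinearEquiv.ofEq _ _ hr).trans eW.symm))
  have hf : ∀ x, W.nicholsι (f x) = F (V.nicholsι x) := by
    intro x
    have : eW (f x) = LinearEquiv.ofEq _ _ hr (F.toLinearEquiv.submoduleMap _ (eV x)) :=
      eW.apply_symm_apply _
    exact congrArg Subtype.val this
  refine ⟨f, fun a x => nicholsι_injective ?_, fun x => ?_⟩
  · rw [hf, ← nicholsRep_ι, ← nicholsRep_ι, hf]
    exact hF.map_act a (V.nicholsι x)
  -- Coactions are compared inside $kG' \otimes \mathcal B(W)$, into which $kG' \otimes W$ embeds by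
  -- flatness.
  · apply Module.Flat.lTensor_preserves_injective_linearMap (M := MonoidAlgebra k G') W.nicholsι
      nicholsι_injective
    have e := hF.map_coact (V.nicholsι x)
    rw [nicholsCoact_ι] at e
    have e' : F.toLinearEquiv (V.nicholsι x) = W.nicholsι (f x) := (hf x).symm
    have key : ∀ s : MonoidAlgebra k G ⊗[k] V.carrier,
        TensorProduct.map ((φ : MonoidAlgebra k G ≃ₗc[k] MonoidAlgebra k G') : _ →ₗ[k] _)
          F.toLinearMap (V.nicholsι.lTensor (MonoidAlgebra k G) s) =
        W.nicholsι.lTensor (MonoidAlgebra k G') (TensorProduct.map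
          ((φ : MonoidAlgebra k G ≃ₗc[k] MonoidAlgebra k G') : _ →ₗ[k] _) f.toLinearMap s) := by
      intro s
      induction s using TensorProduct.induction_on with
      | zero => simp
      | add a b ha hb => simp only [map_add, ha, hb]
      | tmul a m => exact congrArg (φ a ⊗ₜ[k] ·) (hf m).symm
    exact (nicholsCoact_ι (f x)).symm.trans ((congrArg _ e').symm.trans (e.trans (key _)))

end NicholsEquiv
end YDModule

/-! ### Uniqueness of decompositions into irreducible representations -/

section KrullSchmidt

/-- This cancels the dimension of an irreducible representation from the rank of an isotypic part,
whose multiplicity may be infinite. If $a$ is infinite and $b < a$, then $bn < a \le an$. -/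
theorem Cardinal.le_of_mul_natCast_le {a b : Cardinal.{v}} {n : ℕ} (hn : n ≠ 0)
    (h : a * n ≤ b * n) : a ≤ b := by
  by_contra! hba
  rcases lt_or_ge a Cardinal.aleph0 with ha | ha
  · obtain ⟨c, rfl⟩ := Cardinal.lt_aleph0.1 ha
    obtain ⟨d, rfl⟩ := Cardinal.lt_aleph0.1 (hba.trans ha)
    norm_cast at h hba
    exact absurd (Nat.le_of_mul_le_mul_right h (Nat.pos_of_ne_zero hn)) (not_le.2 hba)
  · have h1 : b * n < a := Cardinal.mul_lt_of_lt ha hba ((Cardinal.natCast_lt_aleph0).trans_le ha)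
    have h2 : a ≤ a * n := Cardinal.le_mul_right (by exact_mod_cast hn)
    exact absurd (h2.trans h) (not_le.2 h1)

variable {k Γ : Type*} [Field k] [Monoid Γ]

/-- A simple module is finitely generated over $k\Gamma$, which is itself finite-dimensional. -/
theorem Representation.IsIrreducible.finiteDimensional [Finite Γ] {X : Type*} [AddCommGroup X]
    [Module k X] (ρ : Representation k Γ X) (hρ : ρ.IsIrreducible) : FiniteDimensional k X := by
  have : Module.Finite k ρ.asModule := Module.Finite.trans (MonoidAlgebra k Γ) _
  exact Module.Finite.equiv ρ.asModuleEquiv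

theorem Representation.IsIrreducible.nontrivial {X : Type*} [AddCommGroup X]
    [Module k X] (ρ : Representation k Γ X) (hρ : ρ.IsIrreducible) : Nontrivial X := by
  have : Nontrivial ρ.asModule := IsSimpleModule.nontrivial (MonoidAlgebra k Γ) _
  exact ρ.asModuleEquiv.symm.nontrivial

variable {I : Type v} {I' : Type v'} [DecidableEq I]
  {X : I → Type w} {Y : I' → Type w'}
  [∀ i, AddCommGroup (X i)] [∀ i, Module k (X i)] [∀ j, AddCommGroup (Y j)] [∀ j, Module k (Y j)]
  {ρ : ∀ i, Representation k Γ (X i)} {σ : ∀ j, Representation k Γ (Y j)}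

/-- Schur's lemma for the matrix entry of $A$ from the summand $i$ to the summand $j$. -/
theorem intertwining_apply_eq_zero (hρ : ∀ i, (ρ i).IsIrreducible)
    (hσ : ∀ j, (σ j).IsIrreducible) (A : (Π₀ i, X i) →ₗ[k] (Π₀ j, Y j))
    (hA : ∀ g x, A (DFinsupp.mapRange.linearMap (fun i => ρ i g) x) =
      DFinsupp.mapRange.linearMap (fun j => σ j g) (A x)) {i : I} {j : I'}
    (hij : IsEmpty ((ρ i).Equiv (σ j))) (x : X i) : A (DFinsupp.single i x) j = 0 := by
  have := hρ i
  have := hσ j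
  let B : (ρ i).IntertwiningMap (σ j) :=
    (DFinsupp.lapply j ∘ₗ A ∘ₗ DFinsupp.lsingle i).intertwiningMap_of_isIntertwiningMap _ _
      fun g x => by
        have := congrArg (· j) (hA g (DFinsupp.single i x))
        simpa using this
  have hB : B = 0 := Subsingleton.elim _ _
  exact DFunLike.congr_fun hB x

/-- By Schur's lemma $A$ embeds the sum over $P$ into the sum over $P'$. The two ranks are $|P|\,d$
and $|P'|\,d$, and $d$ cancels. -/
theorem lift_mk_le_of_intertwining [DecidableEq I'] [Finite Γ] (hρ : ∀ i, (ρ i).IsIrreducible)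
    (hσ : ∀ j, (σ j).IsIrreducible) (A : (Π₀ i, X i) →ₗ[k] (Π₀ j, Y j))
    (hinj : Function.Injective A)
    (hA : ∀ g x, A (DFinsupp.mapRange.linearMap (fun i => ρ i g) x) =
      DFinsupp.mapRange.linearMap (fun j => σ j g) (A x))
    (P : Set I) (P' : Set I') {d : ℕ} (hd : d ≠ 0) (hP : ∀ i ∈ P, Module.finrank k (X i) = d)
    (hP' : ∀ j ∈ P', Module.finrank k (Y j) = d)
    (hPP' : ∀ i ∈ P, ∀ j, j ∉ P' → IsEmpty ((ρ i).Equiv (σ j))) :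
    Cardinal.lift.{v'} (Cardinal.mk P) ≤ Cardinal.lift.{v} (Cardinal.mk P') := by
  classical
  let ext : (Π₀ i : P, X i) →ₗ[k] (Π₀ i, X i) :=
    DFinsupp.lsum ℕ fun i : P => DFinsupp.lsingle (i : I)
  have hext : ∀ x (i : P), ext x i = x i := by
    intro x i
    induction x using DFinsupp.induction with
    | h0 => simp
    | ha s x y _ _ hy =>
      rw [map_add, DFinsupp.add_apply, DFinsupp.add_apply, hy]
      congr 1
      simp only [ext, DFinsupp.lsum_single, DFinsupp.lsingle_apply]
      by_cases h : s = i
      · subst h; simp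
      · rw [DFinsupp.single_apply, DFinsupp.single_apply, dif_neg h,
          dif_neg (fun h' => h (Subtype.ext h'))]
  have hzero : ∀ x, ∀ j ∉ P', A (ext x) j = 0 := by
    intro x j hj
    induction x using DFinsupp.induction with
    | h0 => simp
    | ha s x y _ _ hy =>
      rw [map_add, map_add, DFinsupp.add_apply, hy, add_zero]
      simp only [ext, DFinsupp.lsum_single, DFinsupp.lsingle_apply]
      exact intertwining_apply_eq_zero hρ hσ A hA (hPP' s s.2 j hj) x
  let L : (Π₀ i : P, X i) →ₗ[k] (Π₀ j : P', Y j) :=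
    DFinsupp.subtypeDomainLinearMap k Y (fun j => j ∈ P') ∘ₗ A ∘ₗ ext
  have hL : Function.Injective L := by
    rw [← LinearMap.ker_eq_bot, LinearMap.ker_eq_bot']
    intro x hx
    -- Discarding the coordinates outside $P'$ loses nothing, since they vanish on the sum over $P$.
    have h0 : A (ext x) = 0 := by
      ext j
      by_cases hj : j ∈ P'
      · exact DFunLike.congr_fun hx (⟨j, hj⟩ : P')
      · exact hzero x j hj
    have h1 : ext x = 0 := hinj (h0.trans (map_zero A).symm)
    ext i
    rw [← hext, h1]
    rfl
  have hrank := LinearMap.lift_rank_le_of_injective L hL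
  have e1 : Module.rank k (Π₀ i : P, X i) = Cardinal.lift.{w} (Cardinal.mk P) * d := by
    refine (rank_directSum (R := k) (fun i : P => X i)).trans ?_
    have h : ∀ i : P, Module.rank k (X i) = d := fun i => by
      have := (hρ i).finiteDimensional
      rw [← Module.finrank_eq_rank, hP i i.2]
    simp [h]
  have e2 : Module.rank k (Π₀ j : P', Y j) = Cardinal.lift.{w'} (Cardinal.mk P') * d := by
    refine (rank_directSum (R := k) (fun j : P' => Y j)).trans ?_
    have h : ∀ j : P', Module.rank k (Y j) = d := fun j => by
      have := (hσ j).finiteDimensional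
      rw [← Module.finrank_eq_rank, hP' j j.2]
    simp [h]
  rw [e1, e2, Cardinal.lift_mul, Cardinal.lift_mul, Cardinal.lift_natCast, Cardinal.lift_natCast,
    Cardinal.lift_lift, Cardinal.lift_lift] at hrank
  have h3 := Cardinal.le_of_mul_natCast_le hd hrank
  rw [← Cardinal.lift_le.{max w w'}, Cardinal.lift_lift, Cardinal.lift_lift]
  convert h3

/-- Two families of finite-dimensional irreducible representations with isomorphic direct sums
agree up to a bijection of the index sets and isomorphism. -/
theorem exists_equiv_of_directSum_equiv [DecidableEq I'] [Finite Γ] (hρ : ∀ i, (ρ i).IsIrreducible)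
    (hσ : ∀ j, (σ j).IsIrreducible) (A : (Π₀ i, X i) ≃ₗ[k] (Π₀ j, Y j))
    (hA : ∀ g x, A (DFinsupp.mapRange.linearMap (fun i => ρ i g) x) =
      DFinsupp.mapRange.linearMap (fun j => σ j g) (A x)) :
    ∃ e : I ≃ I', ∀ i, Nonempty ((ρ i).Equiv (σ (e i))) := by
  classical
  have hA' : ∀ g y, A.symm (DFinsupp.mapRange.linearMap (fun j => σ j g) y) =
      DFinsupp.mapRange.linearMap (fun i => ρ i g) (A.symm y) := by
    intro g y
    rw [LinearEquiv.symm_apply_eq, hA, LinearEquiv.apply_symm_apply]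
  have hfin : ∀ (P : Set I) (P' : Set I') {d : ℕ}, d ≠ 0 →
      (∀ i ∈ P, Module.finrank k (X i) = d) → (∀ j ∈ P', Module.finrank k (Y j) = d) →
      (∀ i ∈ P, ∀ j, j ∉ P' → IsEmpty ((ρ i).Equiv (σ j))) →
      (∀ j ∈ P', ∀ i, i ∉ P → IsEmpty ((σ j).Equiv (ρ i))) → Nonempty (P ≃ P') := by
    intro P P' d hd hP hP' h1 h2
    apply Cardinal.lift_mk_eq'.1
    exact le_antisymm
      (lift_mk_le_of_intertwining hρ hσ A.toLinearMap A.injective hA P P' hd hP hP' h1)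
      (lift_mk_le_of_intertwining hσ hρ A.symm.toLinearMap A.symm.injective hA' P' P hd hP' hP h2)
  -- The label of an isomorphism type is the pair of index sets in which it occurs, so both families
  -- get labels in one type. Both components matter: types absent from one family all have the same
  -- empty set there.
  let cls : I → Set I × Set I' := fun i =>
    ({i₂ | Nonempty ((ρ i₂).Equiv (ρ i))}, {j | Nonempty ((σ j).Equiv (ρ i))})
  let cls' : I' → Set I × Set I' := fun j =>
    ({i | Nonempty ((ρ i).Equiv (σ j))}, {j₂ | Nonempty ((σ j₂).Equiv (σ j))})
  have hcls : ∀ i₀ i, cls i = cls i₀ ↔ Nonempty ((ρ i).Equiv (ρ i₀)) := by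
    refine fun i₀ i => ⟨fun h => ?_, fun ⟨e⟩ => ?_⟩
    · have : i ∈ (cls i).1 := ⟨.refl _⟩
      rwa [h] at this
    · exact Prod.ext
        (Set.ext fun _ => ⟨fun ⟨a⟩ => ⟨a.trans e⟩, fun ⟨a⟩ => ⟨a.trans e.symm⟩⟩)
        (Set.ext fun _ => ⟨fun ⟨a⟩ => ⟨a.trans e⟩, fun ⟨a⟩ => ⟨a.trans e.symm⟩⟩)
  have hcls' : ∀ j₀ j, cls' j = cls' j₀ ↔ Nonempty ((σ j).Equiv (σ j₀)) := by
    refine fun j₀ j => ⟨fun h => ?_, fun ⟨e⟩ => ?_⟩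
    · have : j ∈ (cls' j).2 := ⟨.refl _⟩
      rwa [h] at this
    · exact Prod.ext
        (Set.ext fun _ => ⟨fun ⟨a⟩ => ⟨a.trans e⟩, fun ⟨a⟩ => ⟨a.trans e.symm⟩⟩)
        (Set.ext fun _ => ⟨fun ⟨a⟩ => ⟨a.trans e⟩, fun ⟨a⟩ => ⟨a.trans e.symm⟩⟩)
  have hmix : ∀ i j, cls i = cls' j ↔ Nonempty ((ρ i).Equiv (σ j)) := by
    refine fun i j => ⟨fun h => ?_, fun ⟨e⟩ => ?_⟩
    · have : i ∈ (cls i).1 := ⟨.refl _⟩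
      rwa [h] at this
    · exact Prod.ext
        (Set.ext fun _ => ⟨fun ⟨a⟩ => ⟨a.trans e⟩, fun ⟨a⟩ => ⟨a.trans e.symm⟩⟩)
        (Set.ext fun _ => ⟨fun ⟨a⟩ => ⟨a.trans e⟩, fun ⟨a⟩ => ⟨a.trans e.symm⟩⟩)
  have hfiber : ∀ q, Nonempty ({i // cls i = q} ≃ {j // cls' j = q}) := by
    intro q
    have h1 : ∀ i ∈ {i | cls i = q}, ∀ j, j ∉ {j | cls' j = q} →
        IsEmpty ((ρ i).Equiv (σ j)) := fun i hi j hj =>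
      ⟨fun e => hj (((hmix i j).2 ⟨e⟩).symm.trans hi)⟩
    have h2 : ∀ j ∈ {j | cls' j = q}, ∀ i, i ∉ {i | cls i = q} →
        IsEmpty ((σ j).Equiv (ρ i)) := fun j hj i hi =>
      ⟨fun e => hi (((hmix i j).2 ⟨e.symm⟩).trans hj)⟩
    -- If the label occurs in either family, a representative supplies the common dimension $d$;
    -- otherwise both fibres are empty.
    by_cases hq : ∃ i, cls i = q
    · obtain ⟨i₀, rfl⟩ := hq
      have := (hρ i₀).finiteDimensional
      have := (hρ i₀).nontrivial
      refine hfin {i | cls i = cls i₀} {j | cls' j = cls i₀} (d := Module.finrank k (X i₀))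
        Module.finrank_pos.ne' (fun i hi => ?_) (fun j hj => ?_) h1 h2
      · obtain ⟨e⟩ := (hcls i₀ i).1 hi
        exact e.toLinearEquiv.finrank_eq
      · obtain ⟨e⟩ := (hmix i₀ j).1 (Eq.symm hj)
        exact e.toLinearEquiv.finrank_eq.symm
    · by_cases hq' : ∃ j, cls' j = q
      · obtain ⟨j₀, rfl⟩ := hq'
        have := (hσ j₀).finiteDimensional
        have := (hσ j₀).nontrivial
        refine hfin {i | cls i = cls' j₀} {j | cls' j = cls' j₀} (d := Module.finrank k (Y j₀))
          Module.finrank_pos.ne' (fun i hi => ?_) (fun j hj => ?_) h1 h2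
        · obtain ⟨e⟩ := (hmix i j₀).1 hi
          exact e.toLinearEquiv.finrank_eq
        · obtain ⟨e⟩ := (hcls' j₀ j).1 hj
          exact e.toLinearEquiv.finrank_eq
      · have : IsEmpty {i // cls i = q} := ⟨fun i => hq ⟨i.1, i.2⟩⟩
        have : IsEmpty {j // cls' j = q} := ⟨fun j => hq' ⟨j.1, j.2⟩⟩
        exact ⟨Equiv.equivOfIsEmpty _ _⟩
  let F := fun q => Classical.choice (hfiber q)
  refine ⟨(Equiv.sigmaFiberEquiv cls).symm.trans
    ((Equiv.sigmaCongrRight F).trans (Equiv.sigmaFiberEquiv cls')), fun i => ?_⟩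
  exact (hmix i _).1 (F (cls i) ⟨i, rfl⟩).2.symm

end KrullSchmidt

namespace RSR
namespace Choices

/-! ### The arrow module as a sum of induced modules -/

section Induced

variable {k : Type*} {G : Type*} [Field k] [Group G] {R : RSR.{v, w} k G} (D : R.Choices)

/-- The arrow from `1` to `g⁻¹ u(C) g` with label `(i, s)`. -/
def arrowAt (R : RSR.{v, w} k G) (C : ConjClasses G) (i : R.I C) (g : G) (s : R.J C i) :
    R.ArrowOne :=
  ⟨⟨1, g⁻¹ * R.u C * g, C, by
    conv_rhs => rw [← R.mk_u C]
    exact ConjClasses.mk_eq_mk_iff_isConj.2 (isConj_iff.2 ⟨g, by group⟩), i, s⟩, rfl⟩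

theorem arrowOne_ext {C : ConjClasses G} {i : R.I C} {s : R.J C i} {x y x' y' : G} {h h'}
    {e : x = 1} {e' : x' = 1} (hy : y = y') :
    (⟨⟨x, y, C, h, i, s⟩, e⟩ : R.ArrowOne) = ⟨⟨x', y', C, h', i, s⟩, e'⟩ := by
  subst e e' hy
  rfl

theorem arrowAt_congr {C : ConjClasses G} {i : R.I C} {g g' : G}
    (h : g⁻¹ * R.u C * g = g'⁻¹ * R.u C * g') : arrowAt R C i g = arrowAt R C i g' :=
  funext fun _ => arrowOne_ext h

theorem conj_centralizer_mul (C : ConjClasses G) (z : Subgroup.centralizer {R.u C}) (g : G) :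
    ((z : G) * g)⁻¹ * R.u C * (z * g) = g⁻¹ * R.u C * g := by
  have hz : (z : G) * R.u C = R.u C * z := Subgroup.mem_centralizer_singleton_iff.1 z.2
  calc ((z : G) * g)⁻¹ * R.u C * (z * g) = g⁻¹ * (z : G)⁻¹ * (R.u C * z) * g := by group
    _ = g⁻¹ * R.u C * g := by rw [← hz]; group

/-- The copy `x ⊗ g` of `x` in the induced module `X ⊗_{kZ} kG`, as an element of `kQ₁¹`. -/
noncomputable def ind (C : ConjClasses G) (i : R.I C) (g : G) :
    R.X C i →ₗ[k] (R.ArrowOne →₀ k) :=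
  Finsupp.lmapDomain k k (arrowAt R C i g) ∘ₗ (D.basis C i).repr.toLinearMap ∘ₗ
    R.ρ C i (MulOpposite.op ((D.isComplement C).equiv g).1)

theorem ind_apply (C : ConjClasses G) (i : R.I C) (g : G) (x : R.X C i) :
    D.ind C i g x = Finsupp.mapDomain (arrowAt R C i g) ((D.basis C i).repr
      (R.ρ C i (MulOpposite.op ((D.isComplement C).equiv g).1) x)) := rfl

/-- The balancing relation $x \otimes zg = xz \otimes g$: left multiplication by $z$ changes only
the centralizer component of $g$ and does not move the end point $g^{-1}u(C)g$. -/
theorem ind_mul (C : ConjClasses G) (i : R.I C) (z : Subgroup.centralizer {R.u C}) (g : G)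
    (x : R.X C i) : D.ind C i (z * g) x = D.ind C i g (R.ρ C i (MulOpposite.op z) x) := by
  rw [ind_apply, ind_apply, arrowAt_congr (conj_centralizer_mul C z g),
    (D.isComplement C).equiv_mul_left]
  simp only [MulOpposite.op_mul, map_mul, Module.End.mul_apply]

theorem ind_of_mem_reps (C : ConjClasses G) (i : R.I C) {t : G} (ht : t ∈ D.reps C) (s : R.J C i) :
    D.ind C i t (D.basis C i s) = Finsupp.single (arrowAt R C i t s) 1 := by
  have h : ((D.isComplement C).equiv t).1 = 1 :=
    (D.isComplement C).equiv_fst_eq_one_of_mem_of_one_mem (Subgroup.one_mem _) ht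
  rw [ind_apply, h, MulOpposite.op_one, map_one, Module.End.one_apply, Module.Basis.repr_self,
    Finsupp.mapDomain_single]

theorem single_eq_ind (a : R.ArrowOne) :
    Finsupp.single a 1 = D.ind a.1.cls a.1.i (D.theta a.1) (D.basis a.1.cls a.1.i a.1.j) := by
  rw [D.ind_of_mem_reps _ _ (D.theta_mem a.1)]
  congr 1
  have h := D.theta_spec a.1
  rw [a.2, inv_one, one_mul] at h
  exact arrowOne_ext h

theorem theta_arrowAt (C : ConjClasses G) (i : R.I C) {t : G} (ht : t ∈ D.reps C) (s : R.J C i) :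
    D.theta (arrowAt R C i t s).1 = t := by
  refine D.theta_unique _ ht ?_
  simp [arrowAt]

theorem exists_eq_mul_mem_reps (C : ConjClasses G) (g : G) :
    ∃ (z : Subgroup.centralizer {R.u C}) (t : G), t ∈ D.reps C ∧ g = z * t :=
  ⟨((D.isComplement C).equiv g).1, ((D.isComplement C).equiv g).2, Subtype.prop _,
    ((D.isComplement C).equiv_fst_mul_equiv_snd g).symm⟩

/-- The coefficients $\zeta_\theta(h^{-1})$ are exactly the centralizer components built into `ind`.
The balancing relation reduces the check to coset representatives and basis vectors, where it is the
definition of the action. -/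
theorem adjoint_ind (C : ConjClasses G) (i : R.I C) (g h : G) (x : R.X C i) :
    D.adjoint h (D.ind C i g x) = D.ind C i (g * h⁻¹) x := by
  obtain ⟨z, t, ht, rfl⟩ := D.exists_eq_mul_mem_reps C g
  rw [ind_mul, mul_assoc, ind_mul]
  generalize R.ρ C i (MulOpposite.op z) x = x
  have : D.adjoint h ∘ₗ D.ind C i t = D.ind C i (t * h⁻¹) := by
    refine (D.basis C i).ext fun s => ?_
    rw [LinearMap.comp_apply, D.ind_of_mem_reps C i ht, adjoint_single, D.theta_arrowAt C i ht,
      ind_apply]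
    have hc : conjArrow h (arrowAt R C i t s) = arrowAt R C i (t * h⁻¹) := by
      funext s'
      refine arrowOne_ext ?_
      simp only [arrowAt, Arrow.left]
      group
    rw [hc]
    rfl
  exact LinearMap.congr_fun this x

theorem arrowCoact_ind (C : ConjClasses G) (i : R.I C) (g : G) (x : R.X C i) :
    R.arrowCoact (D.ind C i g x) = MonoidAlgebra.of k G (g⁻¹ * R.u C * g) ⊗ₜ[k] D.ind C i g x := by
  rw [ind_apply]
  generalize (D.basis C i).repr _ = c
  have : R.arrowCoact ∘ₗ Finsupp.lmapDomain k k (arrowAt R C i g) =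
      TensorProduct.mk k _ _ (MonoidAlgebra.of k G (g⁻¹ * R.u C * g)) ∘ₗ
        Finsupp.lmapDomain k k (arrowAt R C i g) := by
    ext1 s
    ext1
    simp only [LinearMap.comp_apply, Finsupp.lsingle_apply, Finsupp.lmapDomain_apply,
      Finsupp.mapDomain_single, arrowCoact_single, TensorProduct.mk_apply]
    rfl
  exact LinearMap.congr_fun this c

theorem hom_ext_ind {N : Type*} [AddCommGroup N] [Module k N]
    {F F' : (R.ArrowOne →₀ k) →ₗ[k] N}
    (h : ∀ C i g x, F (D.ind C i g x) = F' (D.ind C i g x)) : F = F' := by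
  ext1 a
  ext1
  simp only [LinearMap.comp_apply, Finsupp.lsingle_apply]
  rw [D.single_eq_ind a, h]

/-- The universal property of `kQ₁¹` as a sum of induced modules. -/
theorem exists_lift {N : Type*} [AddCommGroup N] [Module k N]
    (Φ : ∀ p : Σ C, R.I C, G → R.X p.1 p.2 →ₗ[k] N)
    (hΦ : ∀ p (z : Subgroup.centralizer {R.u p.1}) g x,
      Φ p (z * g) x = Φ p g (R.ρ p.1 p.2 (MulOpposite.op z) x)) :
    ∃ F : (R.ArrowOne →₀ k) →ₗ[k] N, ∀ C i g x, F (D.ind C i g x) = Φ ⟨C, i⟩ g x := by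
  -- The values on the basis are forced, because each arrow is $x_C^{(i,j)} \otimes g_\theta$.
  let F := Finsupp.linearCombination k fun a : R.ArrowOne =>
    Φ ⟨a.1.cls, a.1.i⟩ (D.theta a.1) (D.basis a.1.cls a.1.i a.1.j)
  refine ⟨F, fun C i g x => ?_⟩
  obtain ⟨z, t, ht, rfl⟩ := D.exists_eq_mul_mem_reps C g
  rw [ind_mul, hΦ ⟨C, i⟩ z t x]
  generalize R.ρ C i (MulOpposite.op z) x = x
  have h : F ∘ₗ D.ind C i t = Φ ⟨C, i⟩ t := by
    refine (D.basis C i).ext fun s => ?_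
    rw [LinearMap.comp_apply, D.ind_of_mem_reps C i ht, Finsupp.linearCombination_single, one_smul,
      D.theta_arrowAt C i ht]
    rfl
  exact LinearMap.congr_fun h x

end Induced

end Choices
end RSR

namespace RSR

/-! ### From isomorphic ramification systems to isomorphic arrow modules -/

section ArrowIso

variable {k : Type*} {G G' : Type*} [Field k] [Group G] [Group G']
  {R : RSR.{v, w} k G} {R' : RSR.{v', w'} k G'} {D : R.Choices} {D' : R'.Choices}
  {φ : MonoidAlgebra k G ≃ₐc[k] MonoidAlgebra k G'} {ψ : G ≃* G'}

open Choices

theorem isSemiIso_arrowYD_iff (hψ : ∀ g, φ (MonoidAlgebra.of k G g) = MonoidAlgebra.of k G' (ψ g))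
    (F : (R.ArrowOne →₀ k) ≃ₗ[k] (R'.ArrowOne →₀ k)) :
    YDModule.IsSemiIso φ D.arrowYD D'.arrowYD F ↔
      (∀ g x, F (D.adjoint g x) = D'.adjoint (ψ g) (F x)) ∧
      ∀ x, R'.arrowCoact (F x) =
        TensorProduct.map ((φ : MonoidAlgebra k G ≃ₗc[k] MonoidAlgebra k G') : _ →ₗ[k] _)
          F.toLinearMap (R.arrowCoact x) := by
  have e : ∀ g x, D.adjointRep.asAlgebraHom (MonoidAlgebra.of k G g) x = D.adjoint g x :=
    fun g x => by rw [Representation.asAlgebraHom_of]; rfl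
  have e' : ∀ g x, D'.adjointRep.asAlgebraHom (MonoidAlgebra.of k G' g) x = D'.adjoint g x :=
    fun g x => by rw [Representation.asAlgebraHom_of]; rfl
  constructor
  · intro h
    refine ⟨fun g x => ?_, h.map_coact⟩
    have := h.map_act (MonoidAlgebra.of k G g) x
    rw [hψ] at this
    rw [← e, ← e']
    exact this
  · intro h
    refine ⟨fun a (x : R.ArrowOne →₀ k) => ?_, h.2⟩
    change F (D.adjointRep.asAlgebraHom a x) = D'.adjointRep.asAlgebraHom (φ a) (F x)
    induction a using MonoidAlgebra.induction_on with
    | add a b ha hb => simp only [map_add, LinearMap.add_apply, ha, hb]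
    | smul r a ha => simp only [map_smul, LinearMap.smul_apply, ha]
    | of g => rw [hψ, e, e', h.1]

theorem centralizerMap_surjective (ψ : G ≃* G') (h a : G) (b : G') (hb : ψ (h⁻¹ * a * h) = b) :
    Function.Surjective (centralizerMap ψ h a b hb) := by
  intro z
  have hz : (z : G') * b = b * z := Subgroup.mem_centralizer_singleton_iff.1 z.2
  refine ⟨⟨h * ψ.symm z * h⁻¹, ?_⟩, ?_⟩
  · rw [Subgroup.mem_centralizer_singleton_iff]
    have hb' : ψ.symm b = h⁻¹ * a * h := by rw [← hb, ψ.symm_apply_apply]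
    have hz' := congrArg ψ.symm hz
    rw [map_mul, map_mul, hb'] at hz'
    calc h * ψ.symm z * h⁻¹ * a = h * (ψ.symm z * (h⁻¹ * a * h)) * h⁻¹ := by group
      _ = h * (h⁻¹ * a * h * ψ.symm z) * h⁻¹ := by rw [hz']
      _ = a * (h * ψ.symm z * h⁻¹) := by group
  · apply Subtype.ext
    change ψ (h⁻¹ * (h * ψ.symm z * h⁻¹) * h) = z
    rw [show h⁻¹ * (h * ψ.symm z * h⁻¹) * h = ψ.symm z by group, ψ.apply_symm_apply]

/-- The bijection between conjugacy classes induced by a group isomorphism. -/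
noncomputable def conjClassesEquiv (ψ : G ≃* G') : ConjClasses G ≃ ConjClasses G' :=
  Equiv.ofBijective (ConjClasses.map ψ.toMonoidHom) (by
    refine ⟨fun a b => ?_, ConjClasses.map_surjective ψ.surjective⟩
    obtain ⟨a, rfl⟩ := ConjClasses.mk_surjective a
    obtain ⟨b, rfl⟩ := ConjClasses.mk_surjective b
    intro h
    have h' := ConjClasses.mk_eq_mk_iff_isConj.1 h
    have h2 := ψ.symm.toMonoidHom.map_isConj h'
    rw [ConjClasses.mk_eq_mk_iff_isConj]
    simpa using h2)

/-- The map is $x \otimes g \mapsto T x \otimes \psi(h^{-1}g)$. It is balanced because $h^{-1}zg =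
(h^{-1}zh)(h^{-1}g)$, and it sends degree $g^{-1}ug$ to $\psi(g^{-1}ug)$. Its inverse is $y \otimes
g' \mapsto T^{-1}y \otimes h\psi^{-1}(g')$. All pairs $(C,i)$ are indexed at once, so that a single
bijection $E$ handles the dependent index sets. -/
theorem exists_isSemiIso_of_equiv (D : R.Choices) (D' : R'.Choices) (ψ : G ≃* G')
    (E : (Σ C, R.I C) ≃ (Σ C, R'.I C)) (h : (Σ C, R.I C) → G)
    (hh : ∀ p, ψ ((h p)⁻¹ * R.u p.1 * h p) = R'.u (E p).1)
    (T : ∀ p : Σ C, R.I C, R.X p.1 p.2 ≃ₗ[k] R'.X (E p).1 (E p).2)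
    (hT : ∀ p (z : Subgroup.centralizer {R.u p.1}) x,
      T p (R.ρ p.1 p.2 (MulOpposite.op z) x) = R'.ρ (E p).1 (E p).2
        (MulOpposite.op (centralizerMap ψ (h p) _ _ (hh p) z)) (T p x)) :
    ∃ (φ : MonoidAlgebra k G ≃ₐc[k] MonoidAlgebra k G')
      (f : D.arrowYD.carrier ≃ₗ[k] D'.arrowYD.carrier),
      YDModule.IsSemiIso φ D.arrowYD D'.arrowYD f := by
  obtain ⟨F, hF⟩ := D.exists_lift
    (fun p g => D'.ind (E p).1 (E p).2 (ψ ((h p)⁻¹ * g)) ∘ₗ (T p).toLinearMap)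
    (fun p z g x => by
      simp only [LinearMap.comp_apply, LinearEquiv.coe_coe]
      rw [hT, ← D'.ind_mul]
      congr 2
      change _ = ψ ((h p)⁻¹ * z * h p) * ψ ((h p)⁻¹ * g)
      rw [← map_mul]
      congr 1
      group)
  -- The inverse is described only at indices of the form $E(p)$; transport along $E$ extends the
  -- description to all indices $q$.
  let P : (Σ C, R'.I C) → Type _ := fun q => G' → R'.X q.1 q.2 →ₗ[k] (R.ArrowOne →₀ k)
  let Ψ : ∀ q, P q := E.piCongrLeft P fun p g =>
    D.ind p.1 p.2 (h p * ψ.symm g) ∘ₗ (T p).symm.toLinearMap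
  have hΨ : ∀ p g x, Ψ (E p) g x = D.ind p.1 p.2 (h p * ψ.symm g) ((T p).symm x) := by
    intro p g x
    have : Ψ (E p) = _ := Equiv.piCongrLeft_apply_apply P E _ p
    rw [this]
    rfl
  obtain ⟨F', hF'⟩ := D'.exists_lift Ψ (fun q z g x => by
    obtain ⟨p, rfl⟩ := E.surjective q
    obtain ⟨z, rfl⟩ := centralizerMap_surjective ψ (h p) _ _ (hh p) z
    obtain ⟨x, rfl⟩ := (T p).surjective x
    rw [← hT, hΨ, hΨ, (T p).symm_apply_apply, (T p).symm_apply_apply, ← D.ind_mul]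
    congr 2
    change h p * ψ.symm (ψ ((h p)⁻¹ * z * h p) * g) = _
    rw [map_mul, ψ.symm_apply_apply]
    group)
  have hFp : ∀ p g x, F (D.ind p.1 p.2 g x) =
      D'.ind (E p).1 (E p).2 (ψ ((h p)⁻¹ * g)) (T p x) := fun p g x => hF p.1 p.2 g x
  have hF'p : ∀ p g x, F' (D'.ind (E p).1 (E p).2 g x) =
      D.ind p.1 p.2 (h p * ψ.symm g) ((T p).symm x) := fun p g x =>
    (hF' (E p).1 (E p).2 g x).trans (hΨ p g x)
  have h1 : F' ∘ₗ F = LinearMap.id := D.hom_ext_ind fun C i g x => by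
    have := hFp ⟨C, i⟩ g x
    rw [LinearMap.comp_apply, this, hF'p, ψ.symm_apply_apply, (T _).symm_apply_apply,
      mul_inv_cancel_left]
    rfl
  have h2 : F ∘ₗ F' = LinearMap.id := D'.hom_ext_ind fun C i g x => by
    obtain ⟨p, hp⟩ := E.surjective ⟨C, i⟩
    -- The type of $x$ depends on the index, so the index is kept variable until the equation can be
    -- substituted.
    have key : ∀ q : Σ C, R'.I C, E p = q → ∀ x : R'.X q.1 q.2,
        F (F' (D'.ind q.1 q.2 g x)) = D'.ind q.1 q.2 g x := by
      rintro _ rfl x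
      rw [hF'p, hFp, (T p).apply_symm_apply, inv_mul_cancel_left, ψ.apply_symm_apply]
    exact key ⟨C, i⟩ hp x
  obtain ⟨φ, hφ⟩ : ∃ φ : MonoidAlgebra k G ≃ₐc[k] MonoidAlgebra k G',
      ∀ g, φ (MonoidAlgebra.of k G g) = MonoidAlgebra.of k G' (ψ g) :=
    ⟨MonoidAlgebra.domCongrBialgEquiv k k ψ, fun g => MonoidAlgebra.domCongr_single (R := k) ψ g 1⟩
  have hact : ∀ g, F ∘ₗ D.adjoint g = D'.adjoint (ψ g) ∘ₗ F := fun g =>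
    D.hom_ext_ind fun C i a x => by
      rw [LinearMap.comp_apply, LinearMap.comp_apply, D.adjoint_ind, hFp ⟨C, i⟩, hFp ⟨C, i⟩,
        D'.adjoint_ind, ← map_inv, ← map_mul, mul_assoc]
  have hcoact : R'.arrowCoact ∘ₗ F = TensorProduct.map
      ((φ : MonoidAlgebra k G ≃ₗc[k] MonoidAlgebra k G') : _ →ₗ[k] _) F ∘ₗ R.arrowCoact :=
    D.hom_ext_ind fun C i g x => by
      rw [LinearMap.comp_apply, LinearMap.comp_apply, D.arrowCoact_ind, TensorProduct.map_tmul,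
        hFp ⟨C, i⟩, D'.arrowCoact_ind, ← hh, ← map_inv, ← map_mul, ← map_mul]
      refine congrArg (· ⊗ₜ[k] _) (Eq.trans ?_ (hφ _).symm)
      congr 2
      group
  exact ⟨φ, LinearEquiv.ofLinearMap F F' h2 h1,
    (isSemiIso_arrowYD_iff hφ (LinearEquiv.ofLinearMap F F' h2 h1)).2
      ⟨fun g x => LinearMap.congr_fun (hact g) x, fun x => LinearMap.congr_fun hcoact x⟩⟩

theorem Isomorphic.exists_isSemiIso (h : R.Isomorphic R') (D : R.Choices) (D' : R'.Choices) :
    ∃ (φ : MonoidAlgebra k G ≃ₐc[k] MonoidAlgebra k G')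
      (f : D.arrowYD.carrier ≃ₗ[k] D'.arrowYD.carrier),
      YDModule.IsSemiIso φ D.arrowYD D'.arrowYD f := by
  obtain ⟨ψ, H⟩ := h
  choose h hh e hT using H
  exact exists_isSemiIso_of_equiv D D' ψ (Equiv.sigmaCongr (conjClassesEquiv ψ) e)
    (fun p => h p.1) (fun p => hh p.1)
    (fun p => (Classical.choice (hT p.1 p.2)).toLinearEquiv)
    (fun p z x => (Classical.choice (hT p.1 p.2)).toIntertwiningMap.isIntertwining _ _
      (MulOpposite.op z) x)

end ArrowIso
end RSR

/-- Pulling back along a surjection does not change which subspaces are invariant. -/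
theorem Representation.IsIrreducible.comp_surjective {k Γ Γ' X : Type*} [Field k] [Monoid Γ]
    [Monoid Γ'] [AddCommGroup X] [Module k X] {σ : Representation k Γ' X} (hσ : σ.IsIrreducible)
    {f : Γ →* Γ'} (hf : Function.Surjective f) :
    Representation.IsIrreducible (σ.comp f : Representation k Γ X) := by
  let e : Subrepresentation (σ.comp f : Representation k Γ X) ≃o Subrepresentation σ :=
    { toFun := fun S => ⟨S.toSubmodule, fun g v hv => by
        obtain ⟨g, rfl⟩ := hf g
        exact S.apply_mem_toSubmodule g hv⟩
      invFun := fun S => ⟨S.toSubmodule, fun g v hv => S.apply_mem_toSubmodule (f g) hv⟩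
      left_inv := fun S => rfl
      right_inv := fun S => rfl
      map_rel_iff' := Iff.rfl }
  exact e.isSimpleOrder_iff.2 hσ

/-! ### Homogeneous components of the arrow module -/

namespace RSR

section HomogeneousPart

variable {k : Type*} {G : Type*} [Field k] [Group G] {R : RSR.{v, w} k G} (D : R.Choices)

/-- The projection of a `kG`-comodule onto its part of degree `y`. -/
noncomputable def homogeneousPart (k : Type*) {G M : Type*} [Field k] [Group G] [AddCommGroup M]
    [Module k M] (δ : M →ₗ[k] MonoidAlgebra k G ⊗[k] M) (y : G) : M →ₗ[k] M :=
  (TensorProduct.lid k M).toLinearMap ∘ₗ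
    (Finsupp.lapply y ∘ₗ (MonoidAlgebra.coeffLinearEquiv k).toLinearMap).rTensor M ∘ₗ δ

theorem homogeneousPart_of_eq {M : Type*} [AddCommGroup M] [Module k M]
    (δ : M →ₗ[k] MonoidAlgebra k G ⊗[k] M) {x : M} {y : G}
    (h : δ x = MonoidAlgebra.of k G y ⊗ₜ[k] x) : homogeneousPart k δ y x = x := by
  simp [homogeneousPart, h]

theorem homogeneousPart_of_ne {M : Type*} [AddCommGroup M] [Module k M]
    (δ : M →ₗ[k] MonoidAlgebra k G ⊗[k] M) {x : M} {y z : G}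
    (h : δ x = MonoidAlgebra.of k G z ⊗ₜ[k] x) (hzy : z ≠ y) : homogeneousPart k δ y x = 0 := by
  simp [homogeneousPart, h, hzy]

theorem homogeneousPart_map {G' M M' : Type*} [Group G'] [AddCommGroup M] [Module k M]
    [AddCommGroup M'] [Module k M'] {δ : M →ₗ[k] MonoidAlgebra k G ⊗[k] M}
    {δ' : M' →ₗ[k] MonoidAlgebra k G' ⊗[k] M'} {φ : MonoidAlgebra k G →ₗ[k] MonoidAlgebra k G'}
    {ψ : G ≃* G'} (hψ : ∀ g, φ (MonoidAlgebra.of k G g) = MonoidAlgebra.of k G' (ψ g))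
    {F : M →ₗ[k] M'} (hF : ∀ x, δ' (F x) = TensorProduct.map φ F (δ x)) (y : G) (x : M) :
    homogeneousPart k δ' (ψ y) (F x) = F (homogeneousPart k δ y x) := by
  simp only [homogeneousPart, LinearMap.comp_apply, hF]
  generalize δ x = s
  induction s using TensorProduct.induction_on with
  | zero => simp
  | add a b ha hb => simp only [map_add, ha, hb]
  | tmul a m =>
    induction a using MonoidAlgebra.induction_on with
    | add a b ha hb => simp only [map_add, TensorProduct.add_tmul, ha, hb]
    | smul r a ha => simp only [map_smul, ← TensorProduct.smul_tmul', ha]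
    | of g =>
      rw [TensorProduct.map_tmul, hψ]
      by_cases hg : g = y
      · subst hg; simp
      · simp [hg]

namespace Choices

open Classical in
/-- The sum of the copies `X ⊗ g` of the representation spaces that belong to `C`. -/
noncomputable def indSum (C : ConjClasses G) (g : G) :
    (Π₀ i, R.X C i) →ₗ[k] (R.ArrowOne →₀ k) :=
  DFinsupp.lsum ℕ fun i => D.ind C i g

open Classical in
theorem indSum_single (C : ConjClasses G) (g : G) (i : R.I C) (x : R.X C i) :
    D.indSum C g (DFinsupp.single i x) = D.ind C i g x := by
  simp [indSum]

open Classical in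
theorem hom_ext_dfinsupp {ι N : Type*} {X : ι → Type*} [∀ i, AddCommGroup (X i)]
    [∀ i, Module k (X i)] [AddCommGroup N] [Module k N] {F F' : (Π₀ i, X i) →ₗ[k] N}
    (h : ∀ i x, F (DFinsupp.single i x) = F' (DFinsupp.single i x)) : F = F' :=
  DFinsupp.lhom_ext h

theorem adjoint_indSum (C : ConjClasses G) (g h : G) (x : Π₀ i, R.X C i) :
    D.adjoint h (D.indSum C g x) = D.indSum C (g * h⁻¹) x := by
  refine LinearMap.congr_fun (f := D.adjoint h ∘ₗ D.indSum C g) (g := D.indSum C (g * h⁻¹))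
    (hom_ext_dfinsupp fun i x => ?_) x
  rw [LinearMap.comp_apply, indSum_single, indSum_single, adjoint_ind]

theorem indSum_mul (C : ConjClasses G) (z : Subgroup.centralizer {R.u C}) (g : G)
    (x : Π₀ i, R.X C i) :
    D.indSum C (z * g) x = D.indSum C g
      (DFinsupp.mapRange.linearMap (fun i => R.ρ C i (MulOpposite.op z)) x) := by
  classical
  refine LinearMap.congr_fun (f := D.indSum C (z * g))
    (g := D.indSum C g ∘ₗ DFinsupp.mapRange.linearMap (fun i => R.ρ C i (MulOpposite.op z)))
    (hom_ext_dfinsupp fun i x => ?_) x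
  rw [LinearMap.comp_apply, DFinsupp.mapRange.linearMap_apply, DFinsupp.mapRange_single,
    indSum_single, indSum_single, ind_mul]

theorem homogeneousPart_indSum (C : ConjClasses G) (g : G) (x : Π₀ i, R.X C i) :
    homogeneousPart k R.arrowCoact (g⁻¹ * R.u C * g) (D.indSum C g x) = D.indSum C g x := by
  refine LinearMap.congr_fun
    (f := homogeneousPart k R.arrowCoact (g⁻¹ * R.u C * g) ∘ₗ D.indSum C g) (g := D.indSum C g)
    (hom_ext_dfinsupp fun i x => ?_) x
  rw [LinearMap.comp_apply, indSum_single]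
  exact homogeneousPart_of_eq _ (D.arrowCoact_ind C i g x)

/-- On a generator $x \otimes g'$ of another degree the projection is zero. If the degrees agree,
then the classes agree and $g' = zg$ with $z$ in the centralizer, so $x \otimes g' = xz \otimes g$.
-/
theorem homogeneousPart_mem_range (C : ConjClasses G) (g : G) (x : R.ArrowOne →₀ k) :
    homogeneousPart k R.arrowCoact (g⁻¹ * R.u C * g) x ∈ LinearMap.range (D.indSum C g) := by
  classical
  -- Passing to the quotient makes membership the vanishing of a linear map, which can be tested on
  -- the elements $x \otimes g'$.
  suffices h : (LinearMap.range (D.indSum C g)).mkQ ∘ₗ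
      homogeneousPart k R.arrowCoact (g⁻¹ * R.u C * g) = 0 by
    have := LinearMap.congr_fun h x
    rwa [LinearMap.comp_apply, LinearMap.zero_apply, Submodule.mkQ_apply,
      Submodule.Quotient.mk_eq_zero] at this
  refine D.hom_ext_ind fun C' i g' x => ?_
  rw [LinearMap.comp_apply, LinearMap.zero_apply, Submodule.mkQ_apply,
    Submodule.Quotient.mk_eq_zero]
  by_cases hg : g'⁻¹ * R.u C' * g' = g⁻¹ * R.u C * g
  · have hC : C' = C := by
      rw [← R.mk_u C', ← R.mk_u C, ConjClasses.mk_eq_mk_iff_isConj, isConj_iff]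
      exact ⟨g * g'⁻¹, by
        calc g * g'⁻¹ * R.u C' * (g * g'⁻¹)⁻¹ = g * (g'⁻¹ * R.u C' * g') * g⁻¹ := by group
          _ = R.u C := by rw [hg]; group⟩
    subst hC
    rw [← hg, homogeneousPart_of_eq _ (D.arrowCoact_ind C' i g' x)]
    have hz : g' * g⁻¹ ∈ Subgroup.centralizer {R.u C'} := by
      rw [Subgroup.mem_centralizer_singleton_iff]
      calc g' * g⁻¹ * R.u C' = g' * (g⁻¹ * R.u C' * g) * g⁻¹ := by group
        _ = R.u C' * (g' * g⁻¹) := by rw [← hg]; group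
    have e := D.ind_mul C' i ⟨_, hz⟩ g x
    rw [inv_mul_cancel_right] at e
    exact ⟨DFinsupp.single i _, (D.indSum_single C' g i _).trans e.symm⟩
  · rw [homogeneousPart_of_ne _ (D.arrowCoact_ind C' i g' x) hg]
    exact Submodule.zero_mem _

theorem range_indSum (C : ConjClasses G) (g : G) :
    LinearMap.range (D.indSum C g) =
      LinearMap.range (homogeneousPart k R.arrowCoact (g⁻¹ * R.u C * g)) := by
  apply le_antisymm
  · rintro _ ⟨x, rfl⟩
    exact ⟨_, D.homogeneousPart_indSum C g x⟩
  · rintro _ ⟨x, rfl⟩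
    exact D.homogeneousPart_mem_range C g x

/-- The action of $g$ translates the claim to the copy at $1$. There the universal property provides
the coordinates: $x \otimes g \mapsto xg$ for $g$ in the centralizer, and $0$ otherwise. -/
theorem indSum_injective (C : ConjClasses G) (g : G) : Function.Injective (D.indSum C g) := by
  classical
  suffices h1 : Function.Injective (D.indSum C 1) by
    intro x y hxy
    apply h1
    have := congrArg (D.adjoint g) hxy
    rwa [adjoint_indSum, adjoint_indSum, mul_inv_cancel] at this
  obtain ⟨F, hF⟩ := D.exists_lift (N := ∀ p : Σ C, R.I C, R.X p.1 p.2)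
    (fun p g => if hg : g ∈ Subgroup.centralizer {R.u p.1} then
      LinearMap.single k _ p ∘ₗ R.ρ p.1 p.2 (MulOpposite.op ⟨g, hg⟩) else 0)
    (fun p z g x => by
      by_cases hg : g ∈ Subgroup.centralizer {R.u p.1}
      · have hzg : (z : G) * g ∈ Subgroup.centralizer {R.u p.1} := mul_mem z.2 hg
        have e : (⟨z * g, hzg⟩ : Subgroup.centralizer {R.u p.1}) = z * ⟨g, hg⟩ := rfl
        rw [dif_pos hg, dif_pos hzg, e, MulOpposite.op_mul, map_mul]
        rfl
      · have hzg : ¬ (z : G) * g ∈ Subgroup.centralizer {R.u p.1} := fun h =>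
          hg ((Subgroup.mul_mem_cancel_left _ z.2).1 h)
        rw [dif_neg hg, dif_neg hzg]
        rfl)
  have hF1 : ∀ x i, F (D.indSum C 1 x) ⟨C, i⟩ = x i := by
    intro x i
    refine LinearMap.congr_fun (f := LinearMap.proj (⟨C, i⟩ : Σ C, R.I C) ∘ₗ F ∘ₗ D.indSum C 1)
      (g := DFinsupp.lapply i) (hom_ext_dfinsupp fun j x => ?_) x
    rw [LinearMap.comp_apply, LinearMap.comp_apply, indSum_single, hF,
      dif_pos (Subgroup.one_mem _)]
    have e : (⟨1, Subgroup.one_mem _⟩ : Subgroup.centralizer {R.u C}) = 1 := rfl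
    rw [e, MulOpposite.op_one, map_one]
    by_cases hij : j = i
    · subst hij; simp
    · have : (⟨C, j⟩ : Σ C, R.I C) ≠ ⟨C, i⟩ := fun h => hij (eq_of_heq (Sigma.mk.inj_iff.1 h).2)
      simp [DFinsupp.single_apply, hij, this.symm]
  intro x y hxy
  ext i
  rw [← hF1, ← hF1, hxy]

end Choices
end HomogeneousPart

/-! ### Recovering the ramification system from the arrow module -/

section Recover

variable {k : Type*} {G G' : Type*} [Field k] [Group G] [Group G']
  {R : RSR.{v, w} k G} {R' : RSR.{v', w'} k G'} {D : R.Choices} {D' : R'.Choices}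
  {φ : MonoidAlgebra k G ≃ₐc[k] MonoidAlgebra k G'}

open Choices

/-- $F$ maps the part of degree $u(C)$, which is the copy at $1$, onto the part of degree
$\psi(u(C))$, which is the copy at $\psi(h^{-1})$. The action of $z^{-1}$ gives $x \otimes z = xz
\otimes 1$ on one side. On the other side it gives $y \otimes \psi(h^{-1}z) = y\,\psi(h^{-1}zh)
\otimes \psi(h^{-1})$, hence the twist by $\psi_h$. -/
theorem exists_directSum_equiv {ψ : G ≃* G'}
    (hψ : ∀ g, φ (MonoidAlgebra.of k G g) = MonoidAlgebra.of k G' (ψ g))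
    (F : (R.ArrowOne →₀ k) ≃ₗ[k] (R'.ArrowOne →₀ k))
    (hF : YDModule.IsSemiIso φ D.arrowYD D'.arrowYD F) (C : ConjClasses G) (C' : ConjClasses G')
    (h : G) (hh : ψ (h⁻¹ * R.u C * h) = R'.u C') :
    ∃ A : (Π₀ i, R.X C i) ≃ₗ[k] (Π₀ j, R'.X C' j), ∀ z x,
      A (DFinsupp.mapRange.linearMap (fun i => R.ρ C i z) x) =
        DFinsupp.mapRange.linearMap (fun j => ((R'.ρ C' j).comp
          (MonoidHom.op (centralizerMap ψ h _ _ hh)) :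
            Representation k (Subgroup.centralizer {R.u C})ᵐᵒᵖ _) z) (A x) := by
  obtain ⟨hact, hcoact⟩ := (isSemiIso_arrowYD_iff hψ F).1 hF
  have hy : (ψ h⁻¹)⁻¹ * R'.u C' * ψ h⁻¹ = ψ ((1 : G)⁻¹ * R.u C * 1) := by
    rw [← hh, ← map_inv, ← map_mul, ← map_mul]
    congr 1
    group
  have hmap := homogeneousPart_map (F := F.toLinearMap) hψ hcoact
  have hr : (LinearMap.range (D.indSum C 1)).map F.toLinearMap =
      LinearMap.range (D'.indSum C' (ψ h⁻¹)) := by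
    rw [D.range_indSum, D'.range_indSum, hy]
    ext y
    constructor
    · rintro ⟨_, ⟨x, rfl⟩, rfl⟩
      exact ⟨F x, hmap _ x⟩
    · rintro ⟨x, rfl⟩
      obtain ⟨x, rfl⟩ := F.surjective x
      exact ⟨_, ⟨x, rfl⟩, (hmap _ x).symm⟩
  let A := (LinearEquiv.ofInjective _ (D.indSum_injective C 1)).trans
    ((F.submoduleMap _).trans ((LinearEquiv.ofEq _ _ hr).trans
      (LinearEquiv.ofInjective _ (D'.indSum_injective C' (ψ h⁻¹))).symm))
  have hA : ∀ x, D'.indSum C' (ψ h⁻¹) (A x) = F (D.indSum C 1 x) := by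
    intro x
    have : LinearEquiv.ofInjective _ (D'.indSum_injective C' (ψ h⁻¹)) (A x) =
        LinearEquiv.ofEq _ _ hr (F.submoduleMap _
          (LinearEquiv.ofInjective _ (D.indSum_injective C 1) x)) :=
      LinearEquiv.apply_symm_apply _ _
    exact congrArg Subtype.val this
  refine ⟨A, fun z x => D'.indSum_injective C' (ψ h⁻¹) ?_⟩
  induction z using MulOpposite.rec' with | _ z
  have e1 := D.indSum_mul C z 1 x
  have e2 := D'.indSum_mul C' (centralizerMap ψ h _ _ hh z) (ψ h⁻¹) (A x)
  refine (hA _).trans (Eq.trans ?_ e2)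
  rw [← e1]
  have e3 := D.adjoint_indSum C 1 (z : G)⁻¹ x
  have e4 := D'.adjoint_indSum C' (ψ h⁻¹) (ψ (z : G)⁻¹) (A x)
  rw [inv_inv, one_mul] at e3
  rw [mul_one, ← e3, hact, ← hA, e4]
  congr 2
  change _ = ψ (h⁻¹ * z * h) * ψ h⁻¹
  rw [← map_inv, ← map_mul, ← map_mul]
  congr 1
  group

theorem Isomorphic.of_isSemiIso [Finite G]
    (f : D.arrowYD.carrier ≃ₗ[k] D'.arrowYD.carrier)
    (hf : YDModule.IsSemiIso φ D.arrowYD D'.arrowYD f) : R.Isomorphic R' := by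
  classical
  obtain ⟨ψ, hψ⟩ := YDModule.exists_mulEquiv_of_bialgEquiv φ
  refine ⟨ψ, fun C => ?_⟩
  -- $\psi(u(C))$ and the chosen representative of $\psi(C)$ are conjugate, and any conjugating
  -- element serves.
  obtain ⟨h, hh⟩ : ∃ h : G, ψ (h⁻¹ * R.u C * h) = R'.u (C.map ψ.toMonoidHom) := by
    have e : ConjClasses.mk (ψ (R.u C)) = ConjClasses.mk (R'.u (C.map ψ.toMonoidHom)) := by
      rw [R'.mk_u]
      conv_rhs => rw [← R.mk_u C]
      rfl
    obtain ⟨c, hc⟩ := isConj_iff.1 (ConjClasses.mk_eq_mk_iff_isConj.1 e)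
    refine ⟨ψ.symm c⁻¹, ?_⟩
    rw [← hc]
    simp
  obtain ⟨A, hA⟩ := exists_directSum_equiv hψ f hf C _ h hh
  have hsurj : Function.Surjective (MonoidHom.op (centralizerMap ψ h _ _ hh)) := fun z => by
    obtain ⟨y, hy⟩ := centralizerMap_surjective ψ h _ _ hh z.unop
    exact ⟨MulOpposite.op y, congrArg MulOpposite.op hy⟩
  have : Finite (Subgroup.centralizer {R.u C})ᵐᵒᵖ := Finite.of_equiv _ MulOpposite.opEquiv
  obtain ⟨e, he⟩ := exists_equiv_of_directSum_equiv (R.irreducible C)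
    (fun j => (R'.irreducible _ j).comp_surjective hsurj) A hA
  exact ⟨h, hh, e, he⟩

end Recover
end RSR

/-! ### The equivalence -/

theorem theorem4 {k : Type*} [Field k] {G G' : Type*} [Group G] [Finite G] [Group G'] [Finite G']
    (hG : (Nat.card G : k) ≠ 0) (hG' : (Nat.card G' : k) ≠ 0)
    (R : RSR.{v, w} k G) (R' : RSR.{v', w'} k G') (D : R.Choices) (D' : R'.Choices) :
    List.TFAE
      [R.Isomorphic R',
        ∃ φ : MonoidAlgebra k G ≃ₐc[k] MonoidAlgebra k G',
          D.arrowYD.Isomorphic (YDModule.pullPush φ D'.arrowYD),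
        ∃ φ : MonoidAlgebra k G ≃ₐc[k] MonoidAlgebra k G',
          YDModule.NicholsIsomorphic D.arrowYD D'.arrowYD φ] := by
  tfae_have 1 → 2 := fun h => by
    obtain ⟨φ, hφ⟩ := h.exists_isSemiIso D D'
    exact ⟨φ, (YDModule.isomorphic_pullPush_iff _ _ _).2 hφ⟩
  tfae_have 2 → 3 := fun ⟨φ, h⟩ => by
    obtain ⟨f, hf⟩ := (YDModule.isomorphic_pullPush_iff _ _ _).1 h
    exact ⟨φ, hf.nicholsIsomorphic⟩
  tfae_have 3 → 1 := fun ⟨φ, h⟩ => by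
    obtain ⟨f, hf⟩ := h.exists_isSemiIso
    exact RSR.Isomorphic.of_isSemiIso f hf
  tfae_finish
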